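/- \textbf{Conventions.} The chromatic symmetric function of a finite simple graph $G$ is $X_G=\sum_\kappa\prod_{v\in V(G)}x_{\kappa(v)}$, where $\kappa$ runs over the proper colorings of $G$; it is a formal power series over $\mathbb Q$ in countably many variables. A composition $K=k_1\cdots k_l$ of $n$, written $K\vDash n$, is a sequence of positive integers with sum $n$. Its last part is $k_{-1}=k_l$, its second last part is $k_{-2}=k_{l-1}$, and $K\backslash k_{-1}=k_1\cdots k_{l-1}$. Put $e_K=e_{k_1}\cdots e_{k_l}$, where $e_k$ is the $k$th elementary symmetric function, $w_K=k_1(k_2-1)(k_3-1)\cdots(k_l-1)$, and, for $0\le m\le n$, \[ \Theta_K(m)=\min\{k_1+\cdots+k_j:\ 0\le j\le l,\ k_1+\cdots+k_j\ge m\}-m . \] Let $K_m$ and $P_m$ be the complete graph and the path on $m$ vertices. The KPKP graph $P^g(K_a,K_b^h)=K_a+P_{g+1}+K_b+P_{h+1}$ is obtained by identifying one end of $P_{g+1}$ (a path of length $g$) with a vertex of $K_a$ and the other end with a vertex $u$ of $K_b$, and identifying an end of $P_{h+1}$ with a vertex $v\ne u$ of $K_b$. \textbf{Theorem.} Let $n=a+g+b+h-1$,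 where $g,h\ge 0$, $a\ge 1$ and $b\ge 2$ are integers. Then \begin{align*} \frac{X_{P^g(K_a,K_b^h)}}{(a-1)!\,(b-2)!} ={}&(b-1)\,n\,e_n +\sum_{\substack{\Theta_K(h+1)\ge b-1\\ k_{-1}+k_{-2}\le n-h-1\\ k_{-1}\ge b-1,\ k_{-2}\ge a}} f_1 +\sum_{\substack{\Theta_K(h+1)\ge b-1\\ k_{-1}+k_{-2}\ge n-h\\ k_{-1}\ge\max(a,\,b-1)}} f_1 \\ &+\sum_{\substack{\Theta_K(h+1)\ge b-1\\ k_{-1}\le b-2,\ k_{-2}\ge a\\ k_{-1}\ge a\text{ or }k_{-1}+k_{-2}\le n-h-1}} f_2 -\sum_{\substack{\Theta_K(h+1)\ge b-1\\ k_{-1}+k_{-2}\ge n-h\\ k_{-1}\le\min(a-1,\,b-2)}} f_3 +\sum_{\substack{\Theta_K(h+1)\le b-2,\ k_{-1}\ge b-1\\ k_{-1}+k_{-2}\ge n-h\text{ or }k_{-2}\ge a}} f_3 , \end{align*} where each sum runs over the compositions $K\vDash n$ with at least two parts that satisfy the displayed conditions, and \[ f_1=(b-1)\,w_K\,e_K,\qquad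 f_2=(b-2)\,k_{-1}\,w_{K\backslash k_{-1}}\,e_K,\qquad f_3=(k_{-1}-b+1)\,w_{K\backslash k_{-1}}\,e_K . \] This is a positive $e_I$-expansion: the coefficient $(b-1)n$ of $e_n$ is nonnegative, and so is the coefficient of $e_K$ in every summand $f_1$, $f_2$ or $f_3$, and in $-f_3$ for the sum that carries the minus sign. -/

import Mathlib

/-!
Symmetric functions are formal power series over `ℚ` in the countably many variables
`x_0, x_1, x_2, …`, that is, elements of `MvPowerSeries ℕ ℚ`.
-/

noncomputable section

namespace KPKP

/-! ### Elementary symmetric functions -/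

/-- The elementary symmetric function `e_k = ∑_{i₁ < ⋯ < i_k} x_{i₁} ⋯ x_{i_k}`: its coefficient at
a monomial `x^d` is `1` if the monomial is squarefree of degree `k`, and `0` otherwise. -/
def elem (k : ℕ) : MvPowerSeries ℕ ℚ :=
  open Classical in fun d => if (∀ i, d i ≤ 1) ∧ d.degree = k then 1 else 0

/-- `e_I = e_{i₁} e_{i₂} ⋯` for a composition `I = i₁ i₂ ⋯`. -/
def elemComp {n : ℕ} (I : Composition n) : MvPowerSeries ℕ ℚ :=
  (I.blocks.map elem).prod

/-! ### The chromatic symmetric function -/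

/-- The exponent vector of the monomial `∏_{v ∈ V} x_{κ(v)}`. -/
def content {V : Type*} [Fintype V] (κ : V → ℕ) : ℕ →₀ ℕ :=
  ∑ v, Finsupp.single (κ v) 1

/-- The chromatic symmetric function `X_G = ∑_κ ∏_{v ∈ V(G)} x_{κ(v)}`, where `κ` runs over the
proper colorings of `G`: the coefficient at `x^d` is the number of proper colorings `κ` with
`∏_{v ∈ V(G)} x_{κ(v)} = x^d`. (This number is finite, see `finite_coloring_content` below.) -/
def chromSymm {V : Type*} [Fintype V] (G : SimpleGraph V) : MvPowerSeries ℕ ℚ :=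
  fun d => (Nat.card {κ : G.Coloring ℕ // content κ = d} : ℚ)

theorem finite_coloring_content {V : Type*} [Fintype V] (G : SimpleGraph V) (d : ℕ →₀ ℕ) :
    Finite {κ : G.Coloring ℕ // content κ = d} := by
  have key : ∀ κ : {κ : G.Coloring ℕ // content κ = d}, ∀ v, κ.1 v ∈ d.support := by
    rintro ⟨κ, rfl⟩ v
    rw [Finsupp.mem_support_iff]
    intro h
    unfold content at h
    rw [Finsupp.finsetSum_apply] at h
    have := (Finset.sum_eq_zero_iff.mp h) v (Finset.mem_univ v)
    simp at this
  refine Finite.of_injective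
    (fun κ => (fun v => ⟨κ.1 v, key κ v⟩ : V → {i // i ∈ d.support})) ?_
  intro κ κ' h
  apply Subtype.ext
  apply RelHom.ext
  intro v
  exact congrArg Subtype.val (congrFun h v)

/-! ### Rooted graphs and the KPKP graph -/

/-- A finite simple graph with two roots. The roots may coincide, so that the one-vertex graph
`K_1 = P_1` is included. -/
structure RootedGraph where
  V : Type
  [fintypeV : Fintype V]
  graph : SimpleGraph V
  left : V
  right : V

attribute [instance] RootedGraph.fintypeV

namespace RootedGraph

/-- The vertices of `G + H`: those of `G`, and those of `H` other than its left root. -/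
abbrev SumV (G H : RootedGraph) : Type := G.V ⊕ {x : H.V // x ≠ H.left}

/-- The inclusion of `H` into `G + H`; the left root of `H` goes to the right root of `G`. -/
def inclRight (G H : RootedGraph) : H.V ↪ SumV G H where
  toFun x := open Classical in
    if h : x = H.left then Sum.inl G.right else Sum.inr ⟨x, h⟩
  inj' x y hxy := by
    by_cases hx : x = H.left <;> by_cases hy : y = H.left <;> simp_all

/-- The graph `G + H` obtained by identifying the right root of `G` with the left root of `H`; its
roots are the left root of `G` and the right root of `H`. -/
def add (G H : RootedGraph) : RootedGraph where
  V := SumV G H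
  fintypeV := open Classical in inferInstance
  graph := G.graph.map Function.Embedding.inl ⊔ H.graph.map (inclRight G H)
  left := Sum.inl G.left
  right := inclRight G H H.right

/-- The complete graph `K_m`, rooted at its first and last vertex. -/
def complete (m : ℕ) (hm : 1 ≤ m) : RootedGraph where
  V := Fin m
  graph := ⊤
  left := ⟨0, hm⟩
  right := ⟨m - 1, Nat.sub_lt hm Nat.one_pos⟩

/-- The path `P_m` on `m` vertices, rooted at its two ends. -/
def path (m : ℕ) (hm : 1 ≤ m) : RootedGraph where
  V := Fin m
  graph := SimpleGraph.pathGraph m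
  left := ⟨0, hm⟩
  right := ⟨m - 1, Nat.sub_lt hm Nat.one_pos⟩

/-- The lollipop `K_b^h = K_b + P_{h+1}`. Its left root is a vertex of the clique which, for
`b ≥ 2`, differs from the vertex where the path is attached. -/
def lollipop (b h : ℕ) (hb : 1 ≤ b) : RootedGraph :=
  (complete b hb).add (path (h + 1) h.succ_pos)

/-- The KPKP graph `P^g(K_a, K_b^h) = K_a + P_{g+1} + K_b + P_{h+1}`. -/
def kpkp (a g b h : ℕ) (ha : 1 ≤ a) (hb : 1 ≤ b) : RootedGraph :=
  (complete a ha).add ((path (g + 1) g.succ_pos).add (lollipop b h hb))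

end RootedGraph

/-! ### Functions on compositions -/

/-- `w_I = i₁ (i₂ - 1) (i₃ - 1) ⋯ (i_l - 1)` for a sequence `I = i₁ i₂ ⋯ i_l`
(and `1` for the empty sequence, which plays no role). -/
def w : List ℕ → ℚ
  | [] => 1
  | i :: t => (i : ℚ) * (t.map fun j => (j : ℚ) - 1).prod

variable {n : ℕ}

/-- The last part `k_{-1}` of a composition. -/
def last₁ (K : Composition n) : ℕ := K.blocks.reverse.getD 0 0

/-- The second last part `k_{-2}` of a composition with at least two parts. -/
def last₂ (K : Composition n) : ℕ := K.blocks.reverse.getD 1 0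

/-- `σ_K(m)`: the least partial sum `k₁ + ⋯ + k_j`, `0 ≤ j ≤ ℓ(K)`, that is at least `m`
(for `m ≤ n`, so that there is one). -/
def sigma (K : Composition n) (m : ℕ) : ℕ :=
  sInf {s | ∃ j ≤ K.length, s = K.sizeUpTo j ∧ m ≤ s}

/-- `Θ_K(m) = σ_K(m) - m` (for `m ≤ n`). -/
def Theta (K : Composition n) (m : ℕ) : ℕ := sigma K m - m

/-- The coefficient `(b - 1) w_K` of `f₁`. -/
def c₁ (b : ℕ) (K : Composition n) : ℚ := ((b : ℚ) - 1) * w K.blocks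

/-- The coefficient `(b - 2) k_{-1} w_{K \ k_{-1}}` of `f₂`. -/
def c₂ (b : ℕ) (K : Composition n) : ℚ :=
  ((b : ℚ) - 2) * (last₁ K : ℚ) * w K.blocks.dropLast

/-- The coefficient `(k_{-1} - b + 1) w_{K \ k_{-1}}` of `f₃`. -/
def c₃ (b : ℕ) (K : Composition n) : ℚ :=
  ((last₁ K : ℚ) - (b : ℚ) + 1) * w K.blocks.dropLast

/-- `f₁ = (b - 1) w_K e_K`. -/
def f₁ (b : ℕ) (K : Composition n) : MvPowerSeries ℕ ℚ := c₁ b K • elemComp K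

/-- `f₂ = (b - 2) k_{-1} w_{K \ k_{-1}} e_K`. -/
def f₂ (b : ℕ) (K : Composition n) : MvPowerSeries ℕ ℚ := c₂ b K • elemComp K

/-- `f₃ = (k_{-1} - b + 1) w_{K \ k_{-1}} e_K`. -/
def f₃ (b : ℕ) (K : Composition n) : MvPowerSeries ℕ ℚ := c₃ b K • elemComp K

/-! ### The ranges of summation

A condition on `k_{-2}` presupposes that `K` has at least two parts. -/

open Classical in
/-- The range of the first `f₁`-sum. -/
def A₁ (n a b h : ℕ) : Finset (Composition n) :=
  {K | 2 ≤ K.length ∧ b - 1 ≤ Theta K (h + 1) ∧ last₁ K + last₂ K ≤ n - h - 1 ∧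
    b - 1 ≤ last₁ K ∧ a ≤ last₂ K}

open Classical in
/-- The range of the second `f₁`-sum. -/
def A₂ (n a b h : ℕ) : Finset (Composition n) :=
  {K | 2 ≤ K.length ∧ b - 1 ≤ Theta K (h + 1) ∧ n - h ≤ last₁ K + last₂ K ∧
    max a (b - 1) ≤ last₁ K}

open Classical in
/-- The range of the `f₂`-sum. -/
def A₃ (n a b h : ℕ) : Finset (Composition n) :=
  {K | 2 ≤ K.length ∧ b - 1 ≤ Theta K (h + 1) ∧ last₁ K ≤ b - 2 ∧ a ≤ last₂ K ∧
    (a ≤ last₁ K ∨ last₁ K + last₂ K ≤ n - h - 1)}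

open Classical in
/-- The range of the `f₃`-sum with a negative sign. -/
def A₄ (n a b h : ℕ) : Finset (Composition n) :=
  {K | 2 ≤ K.length ∧ b - 1 ≤ Theta K (h + 1) ∧ n - h ≤ last₁ K + last₂ K ∧
    last₁ K ≤ min (a - 1) (b - 2)}

open Classical in
/-- The range of the `f₃`-sum with a positive sign. -/
def A₅ (n a b h : ℕ) : Finset (Composition n) :=
  {K | 2 ≤ K.length ∧ Theta K (h + 1) ≤ b - 2 ∧ b - 1 ≤ last₁ K ∧
    (n - h ≤ last₁ K + last₂ K ∨ a ≤ last₂ K)}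

end KPKP

end

/-! Write `X a g` for the normalised chromatic symmetric function with `b` and `h` fixed, `L j g`
for that of a clique `K_j` with a path of length `g` attached, and `P m` for that of the path on `m`
vertices. The proof derives recursions for these functions and checks that the claimed expansion
satisfies them.

The recursions come from transfer matrices over finitely many colours. Gluing rooted graphs
multiplies their matrices (`transfer_add`). Multiplying the row vector of `K_a` by the matrix of one
edge gives the row vector of `K_{a+1}` plus `(a - 1) e_a` times that of `K_1`
(`cliqueVec_vecMul_edgeMatrix`). Hence `X a (g+1) = X (a+1) g + (a-1) e_a X 1 g`, and the same
relation holds for `L`. For `a = 1` the clique `K_b` is absorbed step by step into the path behind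
it, which expresses `X 1 g` through `e`, `P` and `L` (`kpkpSymm_one`).

On the side of compositions, the recursion for `L` gives `P n = ∑ w_I e_I` (`path_eq_wSum`), and it
makes `L j g` the sum over compositions of `j + g` with first part at least `j`, weighted by the
reversed `w` (`pathClique_eq`, `compSum_le_head`). The condition `Θ_K(h+1) ≥ b - 1` says that no
partial sum lies in `[h+1, h+b-1]`. Such a composition splits uniquely where it jumps over this
interval (`compSum_gap`), the weight factors at the cut, and the products of `P` and `L` in the case
`a = 1` appear (`tailExpansion_eq`).

Passing from `a` to `a + 1` changes the coefficients only at compositions whose last or second last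
part is exactly `a` (`expansionCoeff_sub`). Deleting that part leaves the expansion for `a = 1` of
order `n - a` (`expansion_step`), which matches the recursion for `X`. Each coefficient of a power
series involves finitely many variables, so the polynomial identity suffices. -/

noncomputable section

namespace KPKP

/-! ### Sums over compositions -/

/-- The last entry of a list. -/
def lastPart (l : List ℕ) : ℕ := l.reverse.getD 0 0

/-- The second last entry of a list. -/
def secondLastPart (l : List ℕ) : ℕ := l.reverse.getD 1 0

theorem lastPart_concat (l : List ℕ) (k : ℕ) : lastPart (l ++ [k]) = k := by simp [lastPart]

theorem secondLastPart_concat (l : List ℕ) (k m : ℕ) :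
    secondLastPart (l ++ [k] ++ [m]) = k := by simp [secondLastPart]

section CompSum

variable {R : Type*} [AddCommMonoid R]

/-- The sum of `F` over the compositions of `n`, viewed as lists. -/
def compSum (n : ℕ) (F : List ℕ → R) : R := ∑ K : Composition n, F K.blocks

theorem compSum_congr {n : ℕ} {F G : List ℕ → R}
    (h : ∀ l : List ℕ, (∀ x ∈ l, 0 < x) → l.sum = n → F l = G l) : compSum n F = compSum n G :=
  Finset.sum_congr rfl fun K _ => h _ (fun _ hx => K.blocks_pos hx) K.blocks_sum

theorem compSum_add {n : ℕ} (F G : List ℕ → R) :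
    compSum n (fun l => F l + G l) = compSum n F + compSum n G :=
  Finset.sum_add_distrib

theorem compSum_const_zero {n : ℕ} : compSum n (fun _ => (0 : R)) = 0 :=
  Finset.sum_const_zero

theorem compSum_eq_zero {n : ℕ} {F : List ℕ → R}
    (h : ∀ l : List ℕ, (∀ x ∈ l, 0 < x) → l.sum = n → F l = 0) : compSum n F = 0 :=
  (compSum_congr h).trans compSum_const_zero

theorem blocks_eq_nil (K : Composition 0) : K.blocks = [] := by
  by_contra h
  obtain ⟨x, l, hx⟩ := List.exists_cons_of_ne_nil h
  have h1 := K.blocks_sum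
  have h2 := K.blocks_pos (i := x) (by simp [hx])
  simp only [hx, List.sum_cons] at h1
  omega

theorem compSum_zero (F : List ℕ → R) : compSum 0 F = F [] := by
  have hc : Fintype.card (Composition 0) = 1 := by simp [composition_card]
  obtain ⟨K, hK⟩ := Fintype.card_eq_one_iff.mp hc
  rw [compSum, Finset.sum_eq_single K (fun K' _ h => absurd (hK K') h) (by simp), blocks_eq_nil]

/-- The reverse of a composition. -/
def revComp {n : ℕ} (K : Composition n) : Composition n where
  blocks := K.blocks.reverse
  blocks_pos h := K.blocks_pos (List.mem_reverse.mp h)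
  blocks_sum := by rw [List.sum_reverse]; exact K.blocks_sum

theorem compSum_reverse (n : ℕ) (F : List ℕ → R) :
    compSum n (fun l => F l.reverse) = compSum n F := by
  refine Fintype.sum_bijective (revComp (n := n)) ?_ _ _ fun K => rfl
  have : Function.Involutive (revComp (n := n)) := fun K => Composition.ext (by simp [revComp])
  exact this.bijective

theorem compSum_succ_cons (n : ℕ) (F : List ℕ → R) :
    compSum (n + 1) F
      = ∑ k ∈ Finset.range (n + 1), compSum (n - k) (fun l => F ((k + 1) :: l)) := by
  unfold compSum
  rw [Finset.sum_sigma']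
  symm
  refine Finset.sum_bij
    (fun (p : (k : ℕ) × Composition (n - k)) hp =>
      (⟨(p.1 + 1) :: p.2.blocks, ?_, ?_⟩ : Composition (n + 1))) ?_ ?_ ?_ ?_
  · intro i hi
    rcases List.mem_cons.mp hi with rfl | hi
    · exact Nat.succ_pos _
    · exact p.2.blocks_pos hi
  · have h1 := p.2.blocks_sum
    simp at hp
    simp only [List.sum_cons, h1]
    omega
  · intros; exact Finset.mem_univ _
  · rintro ⟨k, K⟩ hp ⟨k', K'⟩ hp' h
    have h := congrArg Composition.blocks h
    simp only [List.cons.injEq, Nat.add_right_cancel_iff] at h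
    obtain ⟨rfl, h⟩ := h
    rw [Composition.ext h]
  · rintro K -
    have hsum := K.blocks_sum
    have hpos := @Composition.blocks_pos _ K
    match hK : K.blocks with
    | [] => simp [hK] at hsum
    | x :: l =>
      rw [hK] at hsum
      simp only [hK, List.mem_cons] at hpos
      have hx : 0 < x := hpos (Or.inl rfl)
      simp only [List.sum_cons] at hsum
      refine ⟨⟨x - 1, ⟨l, fun h => hpos (Or.inr h), by omega⟩⟩, by simp; omega, ?_⟩
      apply Composition.ext
      simp only [hK, Nat.sub_add_cancel hx]
  · intros; rfl

theorem compSum_succ_snoc (n : ℕ) (F : List ℕ → R) :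
    compSum (n + 1) F
      = ∑ k ∈ Finset.range (n + 1), compSum (n - k) (fun l => F (l ++ [k + 1])) := by
  rw [← compSum_reverse, compSum_succ_cons]
  refine Finset.sum_congr rfl fun k _ => ?_
  rw [← compSum_reverse]
  simp

/-- The compositions whose last part is `a`. -/
theorem compSum_last_eq {n a : ℕ} (ha : 1 ≤ a) (han : a ≤ n) (F : List ℕ → R) :
    compSum n (fun l => if lastPart l = a then F l else 0)
      = compSum (n - a) (fun l => F (l ++ [a])) := by
  obtain ⟨n, rfl⟩ : ∃ m, n = m + 1 := ⟨n - 1, by omega⟩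
  rw [compSum_succ_snoc, Finset.sum_eq_single (a - 1)]
  · simp [lastPart_concat, Nat.sub_add_cancel ha, show n - (a - 1) = n + 1 - a by omega]
  · intro k _ hk
    exact compSum_eq_zero fun l _ _ => by rw [lastPart_concat, if_neg (by omega)]
  · intro h
    simp at h
    omega

/-- The compositions with at least two parts whose second last part is `a`. -/
theorem compSum_second_last_eq {n a : ℕ} (ha : 1 ≤ a) (han : a < n) (F : List ℕ → R) :
    compSum n (fun l => if 2 ≤ l.length ∧ secondLastPart l = a then F l else 0)
      = compSum (n - a) (fun l => F (l.dropLast ++ [a] ++ [lastPart l])) := by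
  obtain ⟨n, rfl⟩ : ∃ m, n = m + 1 := ⟨n - 1, by omega⟩
  rw [compSum_succ_snoc, show n + 1 - a = (n - a) + 1 by omega, compSum_succ_snoc]
  have hsub : Finset.range (n - a + 1) ⊆ Finset.range (n + 1) := by
    intro i; simp; omega
  rw [← Finset.sum_subset hsub]
  · refine Finset.sum_congr rfl fun k hk => ?_
    simp only [Finset.mem_range] at hk
    have h := compSum_last_eq ha (show a ≤ n - k by omega) (fun l => F (l ++ [k + 1]))
    rw [show n - a - k = n - k - a by omega]
    simp only [List.dropLast_concat, lastPart_concat]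
    rw [← h]
    refine compSum_congr fun l hl hs => ?_
    have h0 : 1 ≤ l.length := by
      rcases l with _ | ⟨x, l⟩
      · simp at hs; omega
      · simp
    simp [h0, lastPart, secondLastPart]
  · intro k hk hk'
    simp only [Finset.mem_range] at hk hk'
    refine compSum_eq_zero fun l hl hs => ?_
    rw [if_neg]
    rintro ⟨h1, h2⟩
    have : a ∈ l := by
      rw [← h2]
      simp only [secondLastPart, List.reverse_append, List.reverse_singleton, List.singleton_append, List.getD_cons_succ]
      rw [List.getD_eq_getElem _ _ (by simp at h1 ⊢; omega)]
      exact List.mem_reverse.mp (List.getElem_mem _)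
    have := List.single_le_sum (fun x _ => Nat.zero_le x) a this
    omega

end CompSum

/-! ### Weights of lists -/

/-- The product `∏ (i_j - 1)` over a list. -/
def predProd (l : List ℕ) : ℚ := (l.map fun j : ℕ => (j : ℚ) - 1).prod

theorem predProd_reverse (l : List ℕ) : predProd l.reverse = predProd l := by
  simp [predProd, List.prod_reverse]

theorem predProd_append (l m : List ℕ) : predProd (l ++ m) = predProd l * predProd m := by
  simp [predProd]

theorem predProd_singleton (k : ℕ) : predProd [k] = (k : ℚ) - 1 := by simp [predProd]

theorem w_cons (k : ℕ) (l : List ℕ) : w (k :: l) = (k : ℚ) * predProd l := by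
  simp [w, predProd, ← List.map_eq_flatMap, Function.comp_def]

theorem w_append {l : List ℕ} (hl : l ≠ []) (m : List ℕ) :
    w (l ++ m) = w l * predProd m := by
  obtain ⟨x, t, rfl⟩ := List.exists_cons_of_ne_nil hl
  rw [List.cons_append, w_cons, w_cons, predProd_append, mul_assoc]

theorem w_concat {l : List ℕ} (hl : l ≠ []) (k : ℕ) :
    w (l ++ [k]) = w l * ((k : ℚ) - 1) := by
  rw [w_append hl, predProd_singleton]

/-- The coefficient `k_{-1} w_{K \ k_{-1}}`. -/
def endWeight (l : List ℕ) : ℚ := (lastPart l : ℚ) * w l.dropLast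

theorem exists_eq_concat {l : List ℕ} (hl : l ≠ []) : ∃ m k, l = m ++ [k] :=
  ⟨l.dropLast, l.getLast hl, (List.dropLast_append_getLast hl).symm⟩

theorem endWeight_concat (l : List ℕ) (k : ℕ) : endWeight (l ++ [k]) = (k : ℚ) * w l := by
  simp [endWeight, lastPart_concat]

/-- With at least two parts this weight is the product of the two end parts and of `k - 1` over the
inner parts. It therefore factors at every cut into `w` read inwards from either end, and it is
invariant under reversal. -/
theorem endWeight_append {l m : List ℕ} (hl : l ≠ []) (hm : m ≠ []) :
    endWeight (l ++ m) = w l * w m.reverse := by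
  obtain ⟨m, k, rfl⟩ := exists_eq_concat hm
  rw [← List.append_assoc, endWeight_concat, w_append hl, List.reverse_append,
    List.reverse_singleton, List.singleton_append, w_cons, predProd_reverse]
  ring

theorem ne_nil_of_two_le {l : List ℕ} (hl : 2 ≤ l.length) : l ≠ [] := by
  rintro rfl
  simp at hl

theorem exists_eq_concat_concat {l : List ℕ} (hl : 2 ≤ l.length) :
    ∃ m j k, l = m ++ [j] ++ [k] := by
  obtain ⟨m, k, rfl⟩ := exists_eq_concat (ne_nil_of_two_le hl)
  obtain ⟨m, j, rfl⟩ := exists_eq_concat (l := m) (by rintro rfl; simp at hl)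
  exact ⟨m, j, k, rfl⟩

theorem endWeight_reverse {l : List ℕ} (hl : 2 ≤ l.length) :
    endWeight l.reverse = endWeight l := by
  obtain ⟨m, k, rfl⟩ := exists_eq_concat (ne_nil_of_two_le hl)
  have hm : m ≠ [] := by rintro rfl; simp at hl
  rw [List.reverse_append, endWeight_append (by simp) (by simpa using hm), endWeight_concat,
    List.reverse_reverse, List.reverse_singleton]
  simp [w]

/-! ### Weighted sums over compositions and the path–clique recursion -/

section Weighted

variable {R : Type*} [CommRing R] (e : ℕ → R)

/-- The product of `e` over a list. -/
def prodMap (l : List ℕ) : R := (l.map e).prod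

theorem prodMap_append (l m : List ℕ) : prodMap e (l ++ m) = prodMap e l * prodMap e m := by
  simp [prodMap]

theorem prodMap_singleton (k : ℕ) : prodMap e [k] = e k := by simp [prodMap]

theorem prodMap_reverse (l : List ℕ) : prodMap e l.reverse = prodMap e l := by
  simp [prodMap, List.prod_reverse]

variable {e} in
theorem compSum_mul (c : R) (n : ℕ) (F : List ℕ → R) :
    compSum n F * c = compSum n (fun l => F l * c) := Finset.sum_mul _ _ _

variable {e} in
theorem mul_compSum (c : R) (n : ℕ) (F : List ℕ → R) :
    c * compSum n F = compSum n (fun l => c * F l) := Finset.mul_sum _ _ _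

-- Unrolling the recursion trades one path edge for one clique vertex at each step, until the path
-- is used up. The step from clique size `j + i` leaves behind `(j + i - 1) e_{j+i} P (g - i)`.
variable {e} in
theorem pathClique_eq {P : ℕ → R} {L : ℕ → ℕ → R} (hL0 : ∀ j, L j 0 = j * e j)
    (hL1 : ∀ g, L 1 g = P (g + 1))
    (hL : ∀ j g, L j (g + 1) = L (j + 1) g + ((j : R) - 1) * e j * L 1 g) (g : ℕ) :
    ∀ j, L j g = ((j : R) + g) * e (j + g)
      + ∑ i ∈ Finset.range g, ((j : R) + i - 1) * e (j + i) * P (g - i) := by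
  induction g with
  | zero => intro j; simp [hL0]
  | succ g ih =>
    intro j
    rw [hL, ih, hL1, Finset.sum_range_succ', show j + 1 + g = j + (g + 1) by omega]
    have : ∀ i ∈ Finset.range g, ((j : R) + ((i + 1 : ℕ) : R) - 1) * e (j + (i + 1))
        * P (g + 1 - (i + 1)) = (((j + 1 : ℕ) : R) + i - 1) * e (j + 1 + i) * P (g - i) := by
      intro i _
      rw [show g + 1 - (i + 1) = g - i by omega, show j + (i + 1) = j + 1 + i by omega]
      push_cast
      ring
    rw [Finset.sum_congr rfl this]
    push_cast
    simp only [add_zero]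
    ring

variable [Algebra ℚ R]

/-- The sum `∑ w_I e_I` over the compositions of `n`. -/
def wSum (n : ℕ) : R := compSum n fun l => algebraMap ℚ R (w l) * prodMap e l

theorem wSum_zero : wSum e 0 = 1 := by simp [wSum, compSum_zero, w, prodMap]

theorem wSum_eq_reverse (n : ℕ) :
    wSum e n = compSum n fun l => algebraMap ℚ R (w l.reverse) * prodMap e l := by
  rw [wSum, ← compSum_reverse]
  simp only [prodMap_reverse]

/-- The weight `φ` of the last part is left free because the `f₂`- and `f₃`-sums both have this
shape, with their bound on the last part built into `φ`. -/
theorem compSum_concat_weight (n : ℕ) (φ : ℕ → ℚ) :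
    compSum (n + 1) (fun l => if 2 ≤ l.length then
        algebraMap ℚ R (φ (lastPart l) * w l.dropLast) * prodMap e l else 0)
      = ∑ k ∈ Finset.range n, algebraMap ℚ R (φ (k + 1)) * e (k + 1) * wSum e (n - k) := by
  rw [compSum_succ_snoc, Finset.sum_range_succ, Nat.sub_self, compSum_zero, if_neg (by simp),
    add_zero]
  refine Finset.sum_congr rfl fun k hk => ?_
  rw [wSum, mul_compSum]
  refine compSum_congr fun l _ hs => ?_
  have hl : 1 ≤ l.length := by
    rcases l with _ | ⟨x, l⟩
    · simp at hs hk; omega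
    · simp
  rw [if_pos (by simp; omega), lastPart_concat, prodMap_append, prodMap_singleton,
    List.dropLast_concat, map_mul]
  ring

theorem wSum_succ (n : ℕ) :
    wSum e (n + 1) = ((n : R) + 1) * e (n + 1)
      + ∑ k ∈ Finset.range n, (k : R) * e (k + 1) * wSum e (n - k) := by
  rw [wSum, compSum_succ_snoc, Finset.sum_range_succ, Nat.sub_self, compSum_zero, add_comm]
  congr 1
  · simp [w, prodMap]
  refine Finset.sum_congr rfl fun k hk => ?_
  rw [wSum, mul_compSum]
  refine compSum_congr fun l _ hs => ?_
  have hl : l ≠ [] := by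
    rintro rfl
    simp at hs hk; omega
  rw [w_concat hl, prodMap_append, prodMap_singleton, map_mul, map_sub, map_natCast, map_one]
  push_cast
  ring

/-- The compositions of `j + g` whose first part is at least `j`. -/
theorem compSum_le_head {j : ℕ} (hj : 1 ≤ j) (g : ℕ) :
    compSum (j + g) (fun l => if j ≤ l.headD 0 then
        algebraMap ℚ R (w l.reverse) * prodMap e l else 0)
      = ((j : R) + g) * e (j + g)
        + ∑ i ∈ Finset.range g, ((j : R) + i - 1) * e (j + i) * wSum e (g - i) := by
  obtain ⟨j, rfl⟩ : ∃ m, j = m + 1 := ⟨j - 1, by omega⟩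
  rw [show j + 1 + g = j + g + 1 by omega, compSum_succ_cons, Finset.sum_range_succ, Nat.sub_self,
    compSum_zero, add_comm]
  congr 1
  · simp [w, prodMap]; ring
  rw [Finset.sum_range_add, Finset.sum_eq_zero, zero_add]
  · refine Finset.sum_congr rfl fun k hk => ?_
    rw [show j + g - (j + k) = g - k by omega, wSum_eq_reverse, mul_compSum]
    refine compSum_congr fun l _ hs => ?_
    have hl : l.reverse ≠ [] := by
      simp only [ne_eq, List.reverse_eq_nil_iff]
      rintro rfl
      simp at hs hk; omega
    rw [if_pos (by simp), List.reverse_cons, w_concat hl, ← List.singleton_append, prodMap_append,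
      prodMap_singleton, map_mul, map_sub, map_natCast, map_one,
      show j + k + 1 = j + 1 + k by omega]
    push_cast
    ring
  · intro k hk
    simp only [Finset.mem_range] at hk
    exact compSum_eq_zero fun l _ _ => by simp; omega

variable {e}

/-- For `j = 1` the formula of `pathClique_eq` is a recursion for `P`, and splitting off the last
part gives the same recursion for the sum over compositions. -/
theorem path_eq_wSum {P : ℕ → R} {L : ℕ → ℕ → R} (hP0 : P 0 = 1) (hL0 : ∀ j, L j 0 = j * e j)
    (hL1 : ∀ g, L 1 g = P (g + 1))
    (hL : ∀ j g, L j (g + 1) = L (j + 1) g + ((j : R) - 1) * e j * L 1 g) (n : ℕ) :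
    P n = wSum e n := by
  induction n using Nat.strong_induction_on with
  | _ n ih =>
    rcases n with _ | n
    · rw [hP0, wSum_zero]
    · rw [← hL1, pathClique_eq hL0 hL1 hL, wSum_succ]
      have : ∀ i ∈ Finset.range n, (((1 : ℕ) : R) + i - 1) * e (1 + i) * P (n - i)
          = (i : R) * e (i + 1) * wSum e (n - i) := by
        intro i hi
        rw [ih _ (by omega), add_comm 1 i]
        push_cast
        ring
      rw [Finset.sum_congr rfl this, add_comm 1 n]
      push_cast
      ring

end Weighted

/-! ### Compositions without partial sums in an interval -/

/-- No partial sum of the list lies in the interval `[h + 1, h + b - 1]`. -/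
def Gap (h b : ℕ) (l : List ℕ) : Prop := ∀ p, p <+: l → p.sum ≤ h ∨ h + b ≤ p.sum

theorem gap_cons_of_le {h b k : ℕ} {l : List ℕ} (hk : k ≤ h) :
    Gap h b (k :: l) ↔ Gap (h - k) b l := by
  constructor
  · intro H p hp
    have := H (k :: p) (by rwa [List.cons_prefix_cons, eq_self_iff_true, true_and])
    simp only [List.sum_cons] at this
    omega
  · intro H p hp
    rcases p with _ | ⟨x, p⟩
    · simp
    · obtain ⟨rfl, hq⟩ := List.cons_prefix_cons.mp hp
      have := H p hq
      simp only [List.sum_cons]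
      omega

theorem gap_cons_of_lt {h b k : ℕ} {l : List ℕ} (hk : h < k) :
    Gap h b (k :: l) ↔ h + b ≤ k := by
  constructor
  · intro H
    have := H [k] (by simp)
    simp at this
    omega
  · intro H p hp
    rcases p with _ | ⟨x, p⟩
    · simp
    · obtain ⟨rfl, hq⟩ := List.cons_prefix_cons.mp hp
      simp only [List.sum_cons]
      omega

-- The prefix `I` collects the parts up to the last partial sum `j ≤ h`; the next part, the head of
-- `J`, must then carry the partial sum to at least `h + b`. The induction strips the first part: a
-- part of size at most `h` shifts the interval, a larger one must cross it at once.
open Classical in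
theorem compSum_gap {R : Type*} [AddCommMonoid R] {b : ℕ} (hb : 1 ≤ b) (h : ℕ) :
    ∀ (n : ℕ) (F : List ℕ → R), h + b ≤ n →
      compSum n (fun l => if Gap h b l then F l else 0)
        = ∑ j ∈ Finset.range (h + 1), compSum j (fun I => compSum (n - j)
            (fun J => if h + b ≤ j + J.headD 0 then F (I ++ J) else 0)) := by
  induction h using Nat.strong_induction_on with
  | _ h ih =>
    intro n F hn
    obtain ⟨n, rfl⟩ : ∃ m, n = m + 1 := ⟨n - 1, by omega⟩
    rw [Finset.sum_range_succ', compSum_zero, Nat.sub_zero]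
    simp only [List.nil_append, zero_add, compSum_succ_cons]
    rw [show n + 1 = h + (n + 1 - h) by omega, Finset.sum_range_add, Finset.sum_range_add,
      ← add_assoc]
    -- For empty `I`, a first part of size at most `h` cannot reach `h + b`.
    have h0 : ∑ k ∈ Finset.range h, compSum (n - k)
        (fun l => if h + b ≤ ((k + 1) :: l).headD 0 then F ((k + 1) :: l) else 0) = 0 :=
      Finset.sum_eq_zero fun k hk => compSum_eq_zero fun l _ _ => by
        simp at hk ⊢; omega
    rw [h0, add_zero]
    congr 1
    -- Here `k + 1` is the first part of `I` and `i` is the sum of its other parts; reindexing the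
    -- triangle puts the first part in the outer sum.
    · let f : ℕ → ℕ → R := fun k i => compSum i fun I => compSum (n - (k + i)) fun J =>
        if h + b ≤ k + i + 1 + J.headD 0 then F ((k + 1) :: I ++ J) else 0
      have h1 : ∀ m ∈ Finset.range h, ∑ k ∈ Finset.range (m + 1), compSum (m - k) (fun I =>
          compSum (h + (n + 1 - h) - (m + 1)) fun J =>
            if h + b ≤ m + 1 + J.headD 0 then F ((k + 1) :: I ++ J) else 0)
          = ∑ k ∈ Finset.range (m + 1), f k (m - k) := by
        intro m hm
        refine Finset.sum_congr rfl fun k hk => ?_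
        simp only [Finset.mem_range] at hk hm
        simp only [f, show k + (m - k) = m by omega,
          show h + (n + 1 - h) - (m + 1) = n - m by omega]
      rw [Finset.sum_congr rfl h1, Finset.sum_range_diag_flip]
      refine Finset.sum_congr rfl fun k hk => ?_
      simp only [Finset.mem_range] at hk
      simp only [gap_cons_of_le (show k + 1 ≤ h by omega)]
      rw [ih _ (by omega) _ _ (by omega), show h - (k + 1) + 1 = h - k by omega]
      refine Finset.sum_congr rfl fun i hi => ?_
      refine compSum_congr fun I _ _ => ?_
      rw [show n - k - i = n - (k + i) by omega]
      refine compSum_congr fun J _ _ => ?_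
      simp only [Finset.mem_range] at hi
      refine if_congr (by omega) rfl rfl
    · refine Finset.sum_congr rfl fun k _ => compSum_congr fun l _ _ => ?_
      refine if_congr ?_ rfl rfl
      rw [gap_cons_of_lt (by omega)]
      simp

/-! ### The coefficients of the expansion -/

/-- The coefficient `(b - 2) k_{-1} w_{K \ k_{-1}}` of a list. -/
def coeff₂ (b : ℕ) (l : List ℕ) : ℚ := ((b : ℚ) - 2) * (lastPart l : ℚ) * w l.dropLast

/-- The coefficient `(k_{-1} - b + 1) w_{K \ k_{-1}}` of a list. -/
def coeff₃ (b : ℕ) (l : List ℕ) : ℚ := ((lastPart l : ℚ) - (b : ℚ) + 1) * w l.dropLast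

/-- The coefficient `(b - 1) w_K` of a list. -/
def coeff₁ (b : ℕ) (l : List ℕ) : ℚ := ((b : ℚ) - 1) * w l

/-- This is `(b-1)(k-1) = (b-2)k + (k-b+1)` for the last part `k`. It turns every comparison of the
five sums into case distinctions linear in two quantities. -/
theorem coeff₁_eq_add (b : ℕ) {l : List ℕ} (hl : 2 ≤ l.length) :
    coeff₁ b l = coeff₂ b l + coeff₃ b l := by
  obtain ⟨m, j, k, rfl⟩ := exists_eq_concat_concat hl
  rw [coeff₁, coeff₂, coeff₃, lastPart_concat, List.dropLast_concat, w_concat (by simp)]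
  ring

open Classical in
/-- The coefficient of `e_K` in the expansion of a KPKP graph, for `K` with at least two parts. -/
def expansionCoeff (n a b h : ℕ) (l : List ℕ) : ℚ :=
  (if Gap h b l ∧ lastPart l + secondLastPart l ≤ n - h - 1 ∧
      b - 1 ≤ lastPart l ∧ a ≤ secondLastPart l then coeff₁ b l else 0)
  + (if Gap h b l ∧ n - h ≤ lastPart l + secondLastPart l ∧
      max a (b - 1) ≤ lastPart l then coeff₁ b l else 0)
  + (if Gap h b l ∧ lastPart l ≤ b - 2 ∧ a ≤ secondLastPart l ∧
      (a ≤ lastPart l ∨ lastPart l + secondLastPart l ≤ n - h - 1) then coeff₂ b l else 0)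
  - (if Gap h b l ∧ n - h ≤ lastPart l + secondLastPart l ∧
      lastPart l ≤ min (a - 1) (b - 2) then coeff₃ b l else 0)
  + (if ¬ Gap h b l ∧ b - 1 ≤ lastPart l ∧
      (n - h ≤ lastPart l + secondLastPart l ∨ a ≤ secondLastPart l) then coeff₃ b l else 0)

open Classical in
/-- The coefficient of `e_K` in the case `a = 1`. -/
def tailCoeff (b h : ℕ) (l : List ℕ) : ℚ :=
  (if Gap h b l then coeff₂ b l else 0) + (if b - 1 ≤ lastPart l then coeff₃ b l else 0)

/-- The parts before the last two have not passed `h` and the total has crossed the interval, so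
only one partial sum can lie inside. -/
theorem gap_concat_concat_of_le {h b j k : ℕ} {m : List ℕ} (hj : m.sum ≤ h)
    (hn : h + b ≤ m.sum + j + k) : Gap h b (m ++ [j] ++ [k]) ↔ m.sum + j ≤ h ∨ h + b ≤ m.sum + j := by
  constructor
  · intro H
    simpa using H (m ++ [j]) (List.prefix_append _ _)
  · intro H p hp
    rcases List.prefix_concat_iff.mp hp with rfl | hp
    · right; simpa [add_assoc] using hn
    rcases List.prefix_concat_iff.mp hp with rfl | hp
    · simpa using H
    · left
      obtain ⟨q, rfl⟩ := hp
      simp at hj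
      omega

theorem gap_concat_concat_of_lt {h b j k : ℕ} {m : List ℕ} (hm : h < m.sum) :
    Gap h b (m ++ [j] ++ [k]) ↔ Gap h b m := by
  constructor
  · intro H p hp
    exact H p (hp.trans ((List.prefix_append _ _).trans (List.prefix_append _ _)))
  · intro H p hp
    have hq := H m List.prefix_rfl
    rcases List.prefix_concat_iff.mp hp with rfl | hp
    · right; simp; omega
    rcases List.prefix_concat_iff.mp hp with rfl | hp
    · right; simp; omega
    · exact H p hp

theorem gap_concat_of_le {h b k : ℕ} {m : List ℕ} (hm : m.sum ≤ h) (hn : h + b ≤ m.sum + k) :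
    Gap h b (m ++ [k]) := by
  intro p hp
  rcases List.prefix_concat_iff.mp hp with rfl | hp
  · right; simpa using hn
  · left
    obtain ⟨q, rfl⟩ := hp
    simp at hm
    omega

theorem gap_concat_of_lt {h b k : ℕ} {m : List ℕ} (hm : h < m.sum) :
    Gap h b (m ++ [k]) ↔ Gap h b m := by
  constructor
  · intro H p hp
    exact H p (hp.trans (List.prefix_append _ _))
  · intro H p hp
    have hq := H m List.prefix_rfl
    rcases List.prefix_concat_iff.mp hp with rfl | hp
    · right; simp; omega
    · exact H p hp

/-- For `a = 1` the lower bounds by `a` are automatic and the negative sum is empty. What remains is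
the `f₂`-term under the gap condition and the `f₃`-term under `k_{-1} ≥ b - 1`, the two overlapping
in `f₁`. -/
theorem expansionCoeff_one {n b h : ℕ} (hb : 2 ≤ b) (hn : b + h ≤ n) {l : List ℕ}
    (hl : 2 ≤ l.length) (hpos : ∀ x ∈ l, 0 < x) (hs : l.sum = n) :
    expansionCoeff n 1 b h l = tailCoeff b h l := by
  have h1 := coeff₁_eq_add b hl
  unfold expansionCoeff tailCoeff
  rw [h1]
  obtain ⟨m, j, k, rfl⟩ := exists_eq_concat_concat hl
  rw [lastPart_concat, secondLastPart_concat]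
  have hj := hpos j (by simp)
  have hk := hpos k (by simp)
  generalize coeff₂ b _ = x₂
  generalize coeff₃ b _ = x₃
  by_cases hG : Gap h b (m ++ [j] ++ [k])
  · simp only [hG, true_and, not_true_eq_false, false_and, if_false, if_true]
    by_cases hc : j + k ≤ n - h - 1 <;> by_cases hd : b - 1 ≤ k <;>
      simp (disch := omega) only [if_pos, if_neg] <;> ring
  · simp only [hG, not_false_eq_true, true_and, false_and, if_false]
    by_cases hd : b - 1 ≤ k <;>
      simp (disch := omega) only [if_pos, if_neg] <;> ring

/-- If the last two parts begin beyond `h`, the parameter `a` acts as a threshold on the second last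
part; otherwise it acts as one on the last part. In the second case with `k_{-1} = a ≤ b - 2`, an
`f₂`-term is lost and a negative `f₃`-term is gained, which together make `f₁`. -/
theorem expansionCoeff_sub {a g b h n : ℕ} (ha : 1 ≤ a) (hb : 2 ≤ b) (hn : n = a + g + b + h)
    {l : List ℕ} (hl : 2 ≤ l.length) (hpos : ∀ x ∈ l, 0 < x) (hs : l.sum = n) :
    expansionCoeff n a b h l = expansionCoeff n (a + 1) b h l
      + (if secondLastPart l = a then
          (if h < l.dropLast.dropLast.sum then tailCoeff b h l else 0) else 0)
      + (if lastPart l = a then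
          (if l.dropLast.dropLast.sum ≤ h then coeff₁ b l else 0) else 0) := by
  have h1 := coeff₁_eq_add b hl
  unfold expansionCoeff tailCoeff
  rw [h1]
  obtain ⟨m, j, k, rfl⟩ := exists_eq_concat_concat hl
  rw [lastPart_concat, secondLastPart_concat, List.dropLast_concat, List.dropLast_concat]
  have hj := hpos j (by simp)
  have hk := hpos k (by simp)
  generalize coeff₂ b _ = x₂
  generalize coeff₃ b _ = x₃
  simp only [List.sum_append, List.sum_singleton] at hs
  rcases lt_or_ge h m.sum with hm | hm
  · by_cases hG : Gap h b (m ++ [j] ++ [k])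
    · simp only [hG, true_and, not_true_eq_false, false_and, if_false, if_true]
      by_cases hd : b - 1 ≤ k <;> rcases lt_trichotomy j a with hc | hc | hc <;>
        (simp (disch := omega) only [if_pos, if_neg, ite_self]; ring)
    · simp only [hG, not_false_eq_true, true_and, false_and, if_false]
      by_cases hd : b - 1 ≤ k <;> rcases lt_trichotomy j a with hc | hc | hc <;>
        (simp (disch := omega) only [if_pos, if_neg, ite_self]; ring)
  · have hg := gap_concat_concat_of_le (m := m) (b := b) (j := j) (k := k) hm (by omega)
    by_cases hG : Gap h b (m ++ [j] ++ [k])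
    · simp only [hG, true_and, not_true_eq_false, false_and, if_false, if_true]
      rw [hg] at hG
      by_cases hd : b - 1 ≤ k <;> rcases lt_trichotomy k a with hc | hc | hc <;>
        (simp (disch := omega) only [if_pos, if_neg, ite_self]; ring)
    · simp only [hG, not_false_eq_true, true_and, false_and, if_false]
      rw [hg] at hG
      -- The partial sum before the last part lies in `[h+1, h+b-1]`, so the last part is at least
      -- `a + g + 1`: the cases `k ≤ a` cannot occur.
      by_cases hd : b - 1 ≤ k <;> rcases lt_trichotomy k a with hc | hc | hc <;>
        first
        | (exfalso; omega)
        | (simp (disch := omega) only [if_pos, if_neg, ite_self]; ring)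

theorem compSum_length_lt_two {R : Type*} [AddCommMonoid R] {n : ℕ} (hn : 1 ≤ n)
    (F : List ℕ → R) : compSum n (fun l => if l.length < 2 then F l else 0) = F [n] := by
  obtain ⟨n, rfl⟩ : ∃ m, n = m + 1 := ⟨n - 1, by omega⟩
  rw [compSum_succ_snoc, Finset.sum_range_succ, Nat.sub_self, compSum_zero, Finset.sum_eq_zero]
  · simp
  · intro k hk
    simp only [Finset.mem_range] at hk
    refine compSum_eq_zero fun l _ hs => if_neg ?_
    rcases l with _ | ⟨x, l⟩
    · simp at hs; omega
    · simp

/-! ### The recursion of the expansion in `a` -/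

section Expansion

variable {R : Type*} [CommRing R] [Algebra ℚ R] (e : ℕ → R)

/-- The expansion of a KPKP graph of order `n`. -/
def expansion (n a b h : ℕ) : R :=
  algebraMap ℚ R (((b : ℚ) - 1) * n) * e n + compSum n fun l => if 2 ≤ l.length then
    algebraMap ℚ R (expansionCoeff n a b h l) * prodMap e l else 0

/-- The expansion of a KPKP graph of order `n` in the case `a = 1`. -/
def tailExpansion (n b h : ℕ) : R :=
  algebraMap ℚ R (((b : ℚ) - 1) * n) * e n + compSum n fun l => if 2 ≤ l.length then
    algebraMap ℚ R (tailCoeff b h l) * prodMap e l else 0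

theorem expansion_one {n b h : ℕ} (hb : 2 ≤ b) (hn : b + h ≤ n) :
    expansion e n 1 b h = tailExpansion e n b h := by
  unfold expansion tailExpansion
  congr 1
  refine compSum_congr fun l hpos hs => ?_
  split_ifs with hl
  · rw [expansionCoeff_one hb hn hl hpos hs]
  · rfl

/-- Beyond `h` the gap condition is already decided, and an inserted inner part only contributes its
factor `a - 1`. -/
theorem tailCoeff_insert {a b h k : ℕ} {m : List ℕ} (hm : h < m.sum) :
    tailCoeff b h (m ++ [a] ++ [k]) = ((a : ℚ) - 1) * tailCoeff b h (m ++ [k]) := by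
  have hne : m ≠ [] := by rintro rfl; simp at hm
  have hG : Gap h b (m ++ [a] ++ [k]) ↔ Gap h b (m ++ [k]) :=
    (gap_concat_concat_of_lt hm).trans (gap_concat_of_lt hm).symm
  rw [tailCoeff, tailCoeff]
  simp only [coeff₂, coeff₃, lastPart_concat, List.dropLast_concat, w_concat hne]
  by_cases hg : Gap h b (m ++ [k])
  · rw [if_pos hg, if_pos (hG.mpr hg)]
    split_ifs <;> ring
  · rw [if_neg hg, if_neg (hG.not.mpr hg)]
    split_ifs <;> ring

theorem tailCoeff_eq_coeff₁ {b h k : ℕ} {m : List ℕ} (hm : m.sum ≤ h) (hne : m ≠ [])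
    (hn : h + b ≤ m.sum + k) : tailCoeff b h (m ++ [k]) = coeff₁ b (m ++ [k]) := by
  have : 1 ≤ m.length := List.length_pos_iff.mpr hne
  rw [tailCoeff, if_pos (gap_concat_of_le hm hn), if_pos (by rw [lastPart_concat]; omega),
    coeff₁_eq_add _ (by simp; omega)]

/-- The compositions lost when `a` grows are obtained from the compositions `J` of `n - a` by
inserting a part `a`: before the last part of `J` if the earlier parts exceed `h`, and at the end
otherwise. Both insertions multiply the weight by `a - 1`. -/
theorem expansion_step {n a g b h : ℕ} (ha : 1 ≤ a) (hb : 2 ≤ b) (hn : n = a + g + b + h) :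
    expansion e n a b h = expansion e n (a + 1) b h
      + ((a : R) - 1) * e a * tailExpansion e (n - a) b h := by
  let φ := algebraMap ℚ R
  let F₂ : List ℕ → R := fun l =>
    (if h < l.dropLast.dropLast.sum then φ (tailCoeff b h l) else 0) * prodMap e l
  let F₃ : List ℕ → R := fun l => if 2 ≤ l.length then
    (if l.dropLast.dropLast.sum ≤ h then φ (coeff₁ b l) else 0) * prodMap e l else 0
  have hite : ∀ (p : Prop) [Decidable p] (x : ℚ), φ (if p then x else 0) = if p then φ x else 0 := by
    intro p _ x
    split_ifs <;> simp
  have key : compSum n (fun l => if 2 ≤ l.length then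
        φ (expansionCoeff n a b h l) * prodMap e l else 0)
      = compSum n (fun l => if 2 ≤ l.length then
        φ (expansionCoeff n (a + 1) b h l) * prodMap e l else 0)
      + compSum n (fun l => if 2 ≤ l.length ∧ secondLastPart l = a then F₂ l else 0)
      + compSum n (fun l => if lastPart l = a then F₃ l else 0) := by
    rw [← compSum_add, ← compSum_add]
    refine compSum_congr fun l hpos hs => ?_
    by_cases hl : 2 ≤ l.length
    · rw [if_pos hl, if_pos hl, expansionCoeff_sub ha hb hn hl hpos hs]
      simp only [F₂, F₃, hl, true_and, if_true, map_add, add_mul]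
      simp only [hite, ite_mul, zero_mul]
    · simp [F₃, hl]
  -- The leading term of the tail expansion is the one-part composition weighted by `coeff₁`, so it
  -- can join the sum over `J`.
  have hsingle : φ (((b : ℚ) - 1) * (n - a : ℕ)) * e (n - a)
      = compSum (n - a) (fun l => if l.length < 2 then φ (coeff₁ b l) * prodMap e l else 0) := by
    rw [compSum_length_lt_two (by omega), coeff₁, prodMap_singleton]
    simp [w]
  unfold expansion tailExpansion
  rw [key, compSum_second_last_eq ha (by omega), compSum_last_eq ha (by omega), hsingle,
    add_assoc, ← compSum_add, ← compSum_add, mul_compSum, ← add_assoc]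
  congr 1
  refine compSum_congr fun J hpos hs => ?_
  obtain ⟨m, k, rfl⟩ := exists_eq_concat (l := J) (by rintro rfl; simp at hs; omega)
  simp only [List.sum_append, List.sum_singleton] at hs
  have hprod : prodMap e (m ++ [k] ++ [a]) = prodMap e (m ++ [k]) * e a := by
    rw [prodMap_append, prodMap_singleton]
  have hprod' : prodMap e (m ++ [a] ++ [k]) = prodMap e (m ++ [k]) * e a := by
    simp only [prodMap_append, prodMap_singleton]; ring
  have ha' : φ ((a : ℚ) - 1) = (a : R) - 1 := by simp [φ]
  rw [lastPart_concat, List.dropLast_concat]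
  simp only [F₂, F₃, List.dropLast_concat, hprod, hprod']
  rcases lt_or_ge h m.sum with hm | hm
  · have hne : m ≠ [] := by rintro rfl; simp at hm
    have hlen : 1 ≤ m.length := List.length_pos_iff.mpr hne
    have h2 : 2 ≤ (m ++ [k]).length := by simp; omega
    rw [if_pos hm, if_neg (not_le.mpr hm), if_pos h2, if_neg (not_lt.mpr h2), tailCoeff_insert hm,
      ← ha']
    simp only [φ, map_mul, ite_self, zero_mul]
    ring
  · have h2 : 2 ≤ (m ++ [k] ++ [a]).length := by simp
    rw [if_neg (not_lt.mpr hm), if_pos hm, if_pos h2]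
    have hc : coeff₁ b (m ++ [k] ++ [a]) = coeff₁ b (m ++ [k]) * ((a : ℚ) - 1) := by
      rw [coeff₁, coeff₁, w_concat (by simp), mul_assoc]
    rw [hc, map_mul, ha']
    rcases eq_or_ne m [] with rfl | hne
    · rw [if_pos (by simp), if_neg (by simp)]
      ring
    · have hlen : 1 ≤ m.length := List.length_pos_iff.mpr hne
      have h3 : 2 ≤ (m ++ [k]).length := by simp; omega
      rw [if_neg (not_lt.mpr h3), if_pos h3, tailCoeff_eq_coeff₁ hm hne (by omega)]
      ring

end Expansion

/-! ### The expansion in the case `a = 1` -/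

theorem coeff₂_eq (b : ℕ) (l : List ℕ) : coeff₂ b l = ((b : ℚ) - 2) * endWeight l := by
  rw [coeff₂, endWeight, mul_assoc]

theorem lastPart_reverse (l : List ℕ) : lastPart l.reverse = l.headD 0 := by
  cases l <;> simp [lastPart]

section Tail

variable {R : Type*} [CommRing R] [Algebra ℚ R] (e : ℕ → R)

theorem compSum_le_head_coeff₂ (n b m : ℕ) :
    compSum (n + 1) (fun l => if m ≤ l.headD 0 then
        (if 2 ≤ l.length then algebraMap ℚ R (coeff₂ b l) * prodMap e l else 0) else 0)
      = ∑ k ∈ Finset.range n, algebraMap ℚ R (if m ≤ k + 1 then ((b : ℚ) - 2) * (k + 1 : ℕ) else 0)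
          * e (k + 1) * wSum e (n - k) := by
  rw [← compSum_concat_weight e n (fun k => if m ≤ k then ((b : ℚ) - 2) * (k : ℕ) else 0),
    ← compSum_reverse]
  refine compSum_congr fun l _ _ => ?_
  rw [← lastPart_reverse, List.reverse_reverse, List.length_reverse, prodMap_reverse]
  by_cases hl : 2 ≤ l.length
  · rw [if_pos hl, if_pos hl, coeff₂_eq, endWeight_reverse hl, endWeight]
    split_ifs
    · rw [mul_assoc]
    · simp
  · rw [if_neg hl, if_neg hl, ite_self]

-- A nonempty prefix contributes a path factor, and the remainder a sum with bounded first part,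
-- that is, a clique with a path. The last sum comes from the empty prefix; there reversal moves the
-- bound from the first part to the last.
open Classical in
theorem compSum_gap_coeff₂ {b h n : ℕ} (hb : 2 ≤ b) (hn : b + h ≤ n + 1) :
    compSum (n + 1) (fun l => if Gap h b l then
        (if 2 ≤ l.length then algebraMap ℚ R (coeff₂ b l) * prodMap e l else 0) else 0)
      = ∑ j ∈ Finset.range h, ((b : R) - 2) * wSum e (j + 1) *
            compSum (n - j) (fun l => if h + b - (j + 1) ≤ l.headD 0 then
              algebraMap ℚ R (w l.reverse) * prodMap e l else 0)
        + ∑ k ∈ Finset.range n,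
            algebraMap ℚ R (if h + b ≤ k + 1 then ((b : ℚ) - 2) * (k + 1 : ℕ) else 0)
              * e (k + 1) * wSum e (n - k) := by
  rw [compSum_gap (by omega) h _ _ (by omega), Finset.sum_range_succ', compSum_zero]
  simp only [List.nil_append, zero_add, Nat.sub_zero]
  rw [compSum_le_head_coeff₂]
  congr 1
  refine Finset.sum_congr rfl fun j hj => ?_
  simp only [Finset.mem_range] at hj
  rw [wSum, mul_assoc, compSum_mul, mul_compSum]
  refine compSum_congr fun I _ hI => ?_
  rw [mul_compSum, mul_compSum, show n + 1 - (j + 1) = n - j by omega]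
  refine compSum_congr fun J _ hJ => ?_
  have hI' : I ≠ [] := by rintro rfl; simp at hI
  have hJ' : J ≠ [] := by rintro rfl; simp at hJ; omega
  have hl : 2 ≤ (I ++ J).length := by
    have := List.length_pos_iff.mpr hI'
    have := List.length_pos_iff.mpr hJ'
    simp only [List.length_append]
    omega
  by_cases hc : h + b ≤ j + 1 + J.headD 0
  · rw [if_pos hc, if_pos hl, if_pos (by omega), coeff₂_eq, endWeight_append hI' hJ',
      prodMap_append]
    simp only [map_mul, map_sub, map_natCast, map_ofNat]
    ring
  · rw [if_neg hc, if_neg (by omega), mul_zero, mul_zero]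

open Classical in
theorem tailExpansion_eq_add (n b h : ℕ) :
    tailExpansion e (n + 1) b h = algebraMap ℚ R (((b : ℚ) - 1) * (n + 1 : ℕ)) * e (n + 1)
      + compSum (n + 1) (fun l => if Gap h b l then
        (if 2 ≤ l.length then algebraMap ℚ R (coeff₂ b l) * prodMap e l else 0) else 0)
      + ∑ k ∈ Finset.range n,
          algebraMap ℚ R (if b - 1 ≤ k + 1 then ((k + 1 : ℕ) : ℚ) - b + 1 else 0)
            * e (k + 1) * wSum e (n - k) := by
  rw [← compSum_concat_weight e n (fun k => if b - 1 ≤ k then (k : ℚ) - b + 1 else 0),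
    tailExpansion, add_assoc, ← compSum_add]
  congr 1
  refine compSum_congr fun l _ _ => ?_
  by_cases hl : 2 ≤ l.length
  · simp only [if_pos hl, tailCoeff, coeff₃]
    split_ifs <;> simp only [map_add, map_zero, add_mul, zero_mul]
  · simp [hl]

/-- Nonempty prefixes of sum `h - s` give the products of paths with `L (b + s)`. The leading term,
the empty prefix and the `f₃`-terms with last part at least `b + h` combine to `(b - 1) L (b + h)`;
the `f₃`-terms with last part `b + s`, `s < h`, remain. -/
theorem tailExpansion_eq {b : ℕ} (hb : 2 ≤ b) (h g : ℕ) {L : ℕ → R}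
    (hL : ∀ j, L j = ((j : R) + g) * e (j + g)
      + ∑ i ∈ Finset.range g, ((j : R) + i - 1) * e (j + i) * wSum e (g - i)) :
    tailExpansion e (b + h + g) b h = ((b : R) - 1) * L (b + h)
      + ((b : R) - 2) * ∑ s ∈ Finset.range h, wSum e (h - s) * L (b + s)
      + ∑ s ∈ Finset.range h, ((s : R) + 1) * e (b + s) * wSum e (h + g - s) := by
  obtain ⟨c, rfl⟩ : ∃ c, b = c + 1 := ⟨b - 1, by omega⟩
  rw [show c + 1 + h + g = c + h + g + 1 by omega, tailExpansion_eq_add,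
    compSum_gap_coeff₂ e hb (by omega)]
  have h1 : ∑ j ∈ Finset.range h, (((c + 1 : ℕ) : R) - 2) * wSum e (j + 1) *
        compSum (c + h + g - j) (fun l => if h + (c + 1) - (j + 1) ≤ l.headD 0 then
          algebraMap ℚ R (w l.reverse) * prodMap e l else 0)
      = (((c + 1 : ℕ) : R) - 2) *
        ∑ s ∈ Finset.range h, wSum e (h - s) * L (c + 1 + s) := by
    rw [Finset.mul_sum, ← Finset.sum_range_reflect]
    refine Finset.sum_congr rfl fun s hs => ?_
    simp only [Finset.mem_range] at hs
    rw [show h - 1 - s + 1 = h - s by omega, show h + (c + 1) - (h - s) = c + 1 + s by omega,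
      show c + h + g - (h - 1 - s) = c + 1 + s + g by omega, compSum_le_head e (by omega), ← hL]
    ring
  have h2 : ∑ k ∈ Finset.range (c + h + g), algebraMap ℚ R
        (if h + (c + 1) ≤ k + 1 then (((c + 1 : ℕ) : ℚ) - 2) * (k + 1 : ℕ) else 0)
          * e (k + 1) * wSum e (c + h + g - k)
      = ∑ i ∈ Finset.range g, ((c : R) - 1) * ((c : R) + h + i + 1) * e (c + 1 + h + i)
          * wSum e (g - i) := by
    rw [Finset.sum_range_add, Finset.sum_eq_zero, zero_add]
    · refine Finset.sum_congr rfl fun i _ => ?_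
      rw [if_pos (by omega), show c + h + i + 1 = c + 1 + h + i by omega,
        show c + h + g - (c + h + i) = g - i by omega]
      simp only [map_mul, map_sub, map_natCast, map_ofNat]
      push_cast
      ring
    · intro k hk
      simp only [Finset.mem_range] at hk
      rw [if_neg (by omega), map_zero, zero_mul, zero_mul]
  have h3 : ∑ k ∈ Finset.range (c + h + g), algebraMap ℚ R
        (if c + 1 - 1 ≤ k + 1 then ((k + 1 : ℕ) : ℚ) - (c + 1 : ℕ) + 1 else 0)
          * e (k + 1) * wSum e (c + h + g - k)
      = ∑ s ∈ Finset.range h, ((s : R) + 1) * e (c + 1 + s) * wSum e (h + g - s)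
        + ∑ i ∈ Finset.range g, ((h : R) + i + 1) * e (c + 1 + h + i) * wSum e (g - i) := by
    rw [Finset.sum_range_add, Finset.sum_range_add, Finset.sum_eq_zero, zero_add]
    · congr 1
      · refine Finset.sum_congr rfl fun i _ => ?_
        rw [if_pos (by omega), show c + i + 1 = c + 1 + i by omega,
          show c + h + g - (c + i) = h + g - i by omega]
        simp only [map_add, map_sub, map_natCast, map_one]
        push_cast
        ring
      · refine Finset.sum_congr rfl fun i _ => ?_
        rw [if_pos (by omega), show c + h + i + 1 = c + 1 + h + i by omega,
          show c + h + g - (c + h + i) = g - i by omega]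
        simp only [map_add, map_sub, map_natCast, map_one]
        push_cast
        ring
    · intro k hk
      simp only [Finset.mem_range] at hk
      -- The last part `b - 1` satisfies the bound, but its factor `k_{-1} - b + 1` vanishes.
      split_ifs with hc
      · obtain rfl : c = k + 1 := by omega
        push_cast
        simp
      · rw [map_zero, zero_mul, zero_mul]
  -- The identity behind `coeff₁_eq_add` again, for a part of size `b + h + i`.
  have h4 : ∑ i ∈ Finset.range g, (((c + 1 + h : ℕ) : R) + i - 1) * e (c + 1 + h + i)
        * wSum e (g - i) * c
      = ∑ i ∈ Finset.range g, ((c : R) - 1) * ((c : R) + h + i + 1) * e (c + 1 + h + i)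
          * wSum e (g - i)
        + ∑ i ∈ Finset.range g, ((h : R) + i + 1) * e (c + 1 + h + i) * wSum e (g - i) := by
    rw [← Finset.sum_add_distrib]
    refine Finset.sum_congr rfl fun i _ => ?_
    push_cast
    ring
  rw [h1, h2, h3, hL (c + 1 + h), show c + h + g + 1 = c + 1 + h + g by omega]
  rw [← Finset.sum_mul] at h4
  simp only [map_mul, map_sub, map_natCast, map_one]
  push_cast at h4 ⊢
  linear_combination -h4

variable {e}

/-- Sequences that satisfy the recursions of the chromatic symmetric functions of paths, lollipops
and KPKP graphs have the expansion `expansion`. -/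
theorem eq_expansion {P : ℕ → R} {L X : ℕ → ℕ → R} {b h : ℕ} (hb : 2 ≤ b) (hP0 : P 0 = 1)
    (hL0 : ∀ j, L j 0 = j * e j) (hL1 : ∀ g, L 1 g = P (g + 1))
    (hL : ∀ j g, L j (g + 1) = L (j + 1) g + ((j : R) - 1) * e j * L 1 g)
    (hX1 : ∀ g, X 1 g = ((b : R) - 1) * L (b + h) g
      + ((b : R) - 2) * ∑ s ∈ Finset.range h, P (h - s) * L (b + s) g
      + ∑ s ∈ Finset.range h, ((s : R) + 1) * e (b + s) * P (h + g - s))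
    (hX : ∀ a g, X a (g + 1) = X (a + 1) g + ((a : R) - 1) * e a * X 1 g)
    {a : ℕ} (ha : 1 ≤ a) : ∀ g, X a g = expansion e (a + g + b + h - 1) a b h := by
  have hP : P = wSum e := funext (path_eq_wSum hP0 hL0 hL1 hL)
  subst hP
  have h1 : ∀ g, X 1 g = tailExpansion e (b + h + g) b h := fun g => by
    rw [hX1, tailExpansion_eq e hb h g (L := fun j => L j g) (fun j => pathClique_eq hL0 hL1 hL g j)]
  induction a, ha using Nat.le_induction with
  | base =>
    intro g
    rw [h1, show 1 + g + b + h - 1 = b + h + g by omega, expansion_one e hb (by omega)]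
  | succ a ha ih =>
    intro g
    -- The pairs `(a, g + 1)` and `(a + 1, g)` give the same order, so the two recursions can be
    -- compared and their common term cancelled.
    have h2 := expansion_step e (n := a + g + b + h) ha hb rfl
    rw [show a + g + b + h - a = b + h + g by omega, ← h1] at h2
    have h3 := ih (g + 1)
    rw [hX, show a + (g + 1) + b + h - 1 = a + g + b + h by omega, h2] at h3
    rw [show a + 1 + g + b + h - 1 = a + g + b + h by omega]
    exact add_right_cancel h3

end Tail

/-! ### Transfer matrices over a finite set of colours -/

open Matrix

section Transfer

variable {C R : Type*} [CommRing R] (x : C → R)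

/-- The elementary symmetric polynomial of degree `k` in the variables indexed by `S`. -/
def esym (S : Finset C) (k : ℕ) : R := ∑ t ∈ S.powersetCard k, ∏ i ∈ t, x i

theorem esym_zero (S : Finset C) : esym x S 0 = 1 := by simp [esym]

theorem esym_empty_succ (k : ℕ) : esym x ∅ (k + 1) = 0 := by
  rw [esym, Finset.powersetCard_eq_empty.mpr (by simp), Finset.sum_empty]

variable [DecidableEq C]

theorem esym_insert {S : Finset C} {c : C} (hc : c ∉ S) (k : ℕ) :
    esym x (insert c S) (k + 1) = esym x S (k + 1) + x c * esym x S k := by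
  have hmem : ∀ t ∈ S.powersetCard k, c ∉ t := fun t ht h =>
    hc ((Finset.mem_powersetCard.mp ht).1 h)
  rw [esym, Finset.powersetCard_succ_insert hc, Finset.sum_union, Finset.sum_image, esym, esym,
    Finset.mul_sum]
  · congr 1
    exact Finset.sum_congr rfl fun t ht => Finset.prod_insert (hmem t ht)
  · intro t ht t' ht' h
    rw [← Finset.erase_insert (hmem t ht), h, Finset.erase_insert (hmem t' ht')]
  · rw [Finset.disjoint_left]
    intro t ht ht'
    obtain ⟨u, -, rfl⟩ := Finset.mem_image.mp ht'
    exact hc ((Finset.mem_powersetCard.mp ht).1 (Finset.mem_insert_self _ _))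

theorem esym_succ_of_mem {S : Finset C} {c : C} (hc : c ∈ S) (k : ℕ) :
    esym x S (k + 1) = esym x (S.erase c) (k + 1) + x c * esym x (S.erase c) k := by
  rw [← esym_insert x (Finset.notMem_erase c S), Finset.insert_erase hc]

/-- Each set of `k + 1` colours is counted once for each choice of a distinguished element. -/
theorem sum_mul_esym_erase (S : Finset C) :
    ∀ k, ∑ c ∈ S, x c * esym x (S.erase c) k = ((k : R) + 1) * esym x S (k + 1) := by
  induction S using Finset.induction_on with
  | empty => intro k; simp [esym_empty_succ]
  | insert a S ha ih =>
    intro k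
    rw [Finset.sum_insert ha, Finset.erase_insert ha, esym_insert x ha]
    have herase : ∀ c ∈ S, (insert a S).erase c = insert a (S.erase c) := fun c hc =>
      Finset.erase_insert_of_ne (by rintro rfl; exact ha hc)
    have hnot : ∀ c, a ∉ S.erase c := fun c h => ha (Finset.mem_of_mem_erase h)
    rcases k with _ | k
    · have := ih 0
      simp only [esym_zero, mul_one] at this ⊢
      rw [this]
      push_cast
      ring
    · have h1 : ∀ c ∈ S, x c * esym x ((insert a S).erase c) (k + 1)
          = x c * esym x (S.erase c) (k + 1) + x a * (x c * esym x (S.erase c) k) := by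
        intro c hc
        rw [herase c hc, esym_insert x (hnot c)]
        ring
      rw [Finset.sum_congr rfl h1, Finset.sum_add_distrib, ← Finset.mul_sum, ih, ih]
      push_cast
      ring

variable [Fintype C]

/-- The elementary symmetric polynomial in the variables other than `x c`. -/
def esymErase (k : ℕ) (c : C) : R := esym x (Finset.univ.erase c) k

/-- The generating polynomial of `k`-element sets of colours that contain `c`. -/
def cliqueVec (k : ℕ) (c : C) : R := esym x Finset.univ k - esymErase x k c

/-- The transfer matrix of an edge. -/
def edgeMatrix : Matrix C C R := Matrix.of fun c d => if c = d then 0 else x d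

/-- The transfer matrix of a clique on `m + 2` vertices, up to the factor `m!`. -/
def cliqueMatrix (m : ℕ) : Matrix C C R :=
  Matrix.of fun c d => if c = d then 0 else x d * esym x ((Finset.univ.erase c).erase d) m

/-- The generating polynomial of the colourings of a path of length `h` with prescribed colour of
one end, which does not contribute to the weight. -/
def pathVec (h : ℕ) : C → R := (edgeMatrix x ^ h) *ᵥ 1

/-- The chromatic symmetric polynomial of a path on `h` vertices. -/
def pathSymm : ℕ → R
  | 0 => 1
  | h + 1 => ∑ c, x c * pathVec x h c

/-- The chromatic symmetric polynomial of a path of length `g` attached to a clique on `j`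
vertices, up to the factor `(j - 1)!`. -/
def lollipopSymm (j g : ℕ) : R := cliqueVec x j ⬝ᵥ pathVec x g

/-- The chromatic symmetric polynomial of a KPKP graph, up to the factor `(a - 1)! m!`. -/
def kpkpSymm (m h a g : ℕ) : R :=
  (cliqueVec x a ᵥ* edgeMatrix x ^ g) ⬝ᵥ (cliqueMatrix x m *ᵥ pathVec x h)

theorem cliqueVec_zero (c : C) : cliqueVec x 0 c = 0 := by
  simp [cliqueVec, esymErase, esym_zero]

theorem cliqueVec_succ (k : ℕ) (c : C) : cliqueVec x (k + 1) c = x c * esymErase x k c := by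
  rw [cliqueVec, esym_succ_of_mem x (Finset.mem_univ c), esymErase, esymErase]
  ring

theorem cliqueVec_one (c : C) : cliqueVec x 1 c = x c := by
  rw [cliqueVec_succ, esymErase, esym_zero, mul_one]

theorem sum_cliqueVec (k : ℕ) : ∑ c, cliqueVec x k c = k * esym x Finset.univ k := by
  rcases k with _ | k
  · simp [cliqueVec_zero]
  · simp only [cliqueVec_succ, esymErase]
    rw [sum_mul_esym_erase]
    push_cast
    rfl

theorem sum_ite_eq_sub (f : C → R) (c : C) :
    ∑ d, (if c = d then 0 else f d) = ∑ d, f d - f c := by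
  rw [eq_sub_iff_add_eq, ← Finset.sum_erase_add _ _ (Finset.mem_univ c),
    ← Finset.sum_erase_add _ f (Finset.mem_univ c), if_pos rfl, add_zero]
  congr 1
  exact Finset.sum_congr rfl fun d hd => if_neg (Finset.ne_of_mem_erase hd).symm

/-- The entries of `cliqueVec x a` sum to `a e_a`. Removing the one at `d` leaves `(a - 1) e_a` plus
the sets avoiding `d`; multiplied by `x d`, the latter become the sets of size `a + 1` containing
`d`. -/
theorem cliqueVec_vecMul_edgeMatrix (a : ℕ) : cliqueVec x a ᵥ* edgeMatrix x
    = cliqueVec x (a + 1) + (((a : R) - 1) * esym x Finset.univ a) • cliqueVec x 1 := by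
  ext d
  have h1 : ∑ c, cliqueVec x a c * (if c = d then 0 else x d)
      = (∑ c, cliqueVec x a c - cliqueVec x a d) * x d := by
    rw [← sum_ite_eq_sub, Finset.sum_mul]
    exact Finset.sum_congr rfl fun c _ => by
      simp only [eq_comm (a := c)]; split_ifs <;> ring
  simp only [Matrix.vecMul, dotProduct, edgeMatrix, Matrix.of_apply, Pi.add_apply, Pi.smul_apply,
    smul_eq_mul]
  rw [h1, sum_cliqueVec, cliqueVec_succ, cliqueVec_one, cliqueVec]
  ring

theorem pathVec_zero : pathVec x 0 = 1 := by simp [pathVec]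

theorem pathVec_succ (h : ℕ) (c : C) :
    pathVec x (h + 1) c = pathSymm x (h + 1) - x c * pathVec x h c := by
  rw [pathVec, pow_succ', ← Matrix.mulVec_mulVec, ← pathVec, pathSymm,
    ← sum_ite_eq_sub (fun d => x d * pathVec x h d)]
  simp [Matrix.mulVec, dotProduct, edgeMatrix, ite_mul]

theorem lollipopSymm_zero (j : ℕ) : lollipopSymm x j 0 = j * esym x Finset.univ j := by
  rw [lollipopSymm, pathVec_zero, dotProduct_one, sum_cliqueVec]

theorem lollipopSymm_one (g : ℕ) : lollipopSymm x 1 g = pathSymm x (g + 1) := by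
  simp [lollipopSymm, pathSymm, dotProduct, cliqueVec_one]

theorem lollipopSymm_succ (j g : ℕ) : lollipopSymm x j (g + 1)
    = lollipopSymm x (j + 1) g
      + ((j : R) - 1) * esym x Finset.univ j * lollipopSymm x 1 g := by
  rw [lollipopSymm, pathVec, pow_succ', ← Matrix.mulVec_mulVec, Matrix.dotProduct_mulVec,
    cliqueVec_vecMul_edgeMatrix, add_dotProduct, smul_dotProduct, smul_eq_mul]
  rfl

theorem kpkpSymm_succ (m h a g : ℕ) : kpkpSymm x m h a (g + 1)
    = kpkpSymm x m h (a + 1) g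
      + ((a : R) - 1) * esym x Finset.univ a * kpkpSymm x m h 1 g := by
  rw [kpkpSymm, pow_succ', ← Matrix.vecMul_vecMul, cliqueVec_vecMul_edgeMatrix, Matrix.add_vecMul,
    Matrix.smul_vecMul, add_dotProduct, smul_dotProduct, smul_eq_mul]
  rfl

/-- Substituting `pathVec_succ` only in the part of `cliqueVec` that avoids `c` lengthens the clique
and shortens the path, so the product telescopes. -/
theorem cliqueVec_mul_pathVec (c : C) (h : ℕ) : ∀ b, cliqueVec x b c * pathVec x h c
    = ∑ i ∈ Finset.range (h + 1), (esym x Finset.univ (b + i) * pathVec x (h - i) c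
        - esymErase x (b + i) c * pathSymm x (h - i)) := by
  induction h with
  | zero => intro b; simp [pathVec_zero, pathSymm, cliqueVec]
  | succ h ih =>
    intro b
    have h1 := ih (b + 1)
    rw [cliqueVec_succ] at h1
    rw [Finset.sum_range_succ']
    have h2 : ∀ i ∈ Finset.range (h + 1), esym x Finset.univ (b + (i + 1))
          * pathVec x (h + 1 - (i + 1)) c
          - esymErase x (b + (i + 1)) c * pathSymm x (h + 1 - (i + 1))
        = esym x Finset.univ (b + 1 + i) * pathVec x (h - i) c
          - esymErase x (b + 1 + i) c * pathSymm x (h - i) := by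
      intro i _
      rw [show b + (i + 1) = b + 1 + i by omega, show h + 1 - (i + 1) = h - i by omega]
    rw [Finset.sum_congr rfl h2, ← h1]
    simp only [add_zero, Nat.sub_zero, cliqueVec, sub_mul]
    rw [pathVec_succ]
    ring

theorem cliqueMatrix_mulVec_apply (m : ℕ) (f : C → R) (c : C) : (cliqueMatrix x m *ᵥ f) c
    = ∑ d ∈ Finset.univ.erase c, x d * esym x ((Finset.univ.erase c).erase d) m * f d := by
  rw [Matrix.mulVec, dotProduct, ← Finset.sum_erase_add _ _ (Finset.mem_univ c)]
  simp only [cliqueMatrix, Matrix.of_apply, if_true, zero_mul, add_zero]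
  exact Finset.sum_congr rfl fun d hd => by rw [if_neg (Finset.ne_of_mem_erase hd).symm]

/-- The last path edge at the clique is resolved by `pathVec_succ`, and `x d` times the sets
avoiding `c` and `d` is a difference of sets avoiding `c`. The result is a larger clique with a
shorter path, plus terms depending on `c` alone. -/
theorem cliqueMatrix_mulVec_pathVec_succ (m h : ℕ) (c : C) :
    (cliqueMatrix x m *ᵥ pathVec x (h + 1)) c = (cliqueMatrix x (m + 1) *ᵥ pathVec x h) c
      + (m : R) * pathSymm x (h + 1) * esymErase x (m + 1) c
      + cliqueVec x (m + 2) c * pathVec x h c := by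
  rw [cliqueMatrix_mulVec_apply, cliqueMatrix_mulVec_apply]
  have h1 : ∀ d ∈ Finset.univ.erase c,
      x d * esym x ((Finset.univ.erase c).erase d) m * pathVec x (h + 1) d
      = pathSymm x (h + 1) * (x d * esym x ((Finset.univ.erase c).erase d) m)
        - esymErase x (m + 1) c * (x d * pathVec x h d)
        + x d * esym x ((Finset.univ.erase c).erase d) (m + 1) * pathVec x h d := by
    intro d hd
    rw [pathVec_succ, esymErase, esym_succ_of_mem x hd]
    ring
  have h2 : ∑ d ∈ Finset.univ.erase c, x d * pathVec x h d
      = pathSymm x (h + 1) - x c * pathVec x h c := by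
    rw [pathSymm, ← Finset.sum_erase_add _ _ (Finset.mem_univ c)]
    ring
  rw [Finset.sum_congr rfl h1, Finset.sum_add_distrib, Finset.sum_sub_distrib, ← Finset.mul_sum,
    ← Finset.mul_sum, h2, sum_mul_esym_erase, cliqueVec_succ, esymErase]
  ring

theorem cliqueMatrix_mulVec_pathVec (c : C) (h : ℕ) : ∀ m,
    (cliqueMatrix x m *ᵥ pathVec x h) c = ((m : R) + 1) * esymErase x (m + 1 + h) c
      + (m : R) * ∑ s ∈ Finset.range h, pathSymm x (h - s) * esymErase x (m + 1 + s) c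
      + ∑ s ∈ Finset.range h, ((s : R) + 1) * esym x Finset.univ (m + 2 + s)
          * pathVec x (h - 1 - s) c := by
  induction h with
  | zero =>
    intro m
    rw [cliqueMatrix_mulVec_apply, pathVec_zero]
    simp [sum_mul_esym_erase, esymErase]
  | succ h ih =>
    intro m
    rw [cliqueMatrix_mulVec_pathVec_succ, ih, cliqueVec_mul_pathVec, Finset.sum_sub_distrib]
    have h1 : ∑ s ∈ Finset.range (h + 1), pathSymm x (h + 1 - s) * esymErase x (m + 1 + s) c
        = ∑ s ∈ Finset.range h, pathSymm x (h - s) * esymErase x (m + 1 + 1 + s) c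
          + pathSymm x (h + 1) * esymErase x (m + 1) c := by
      rw [Finset.sum_range_succ']
      refine congrArg₂ _ (Finset.sum_congr rfl fun s _ => ?_) rfl
      rw [show h + 1 - (s + 1) = h - s by omega, show m + 1 + (s + 1) = m + 1 + 1 + s by omega]
    have h2 : ∑ i ∈ Finset.range (h + 1), esymErase x (m + 2 + i) c * pathSymm x (h - i)
        = ∑ s ∈ Finset.range h, pathSymm x (h - s) * esymErase x (m + 1 + 1 + s) c
          + esymErase x (m + 1 + 1 + h) c := by
      rw [Finset.sum_range_succ, Nat.sub_self, pathSymm, mul_one]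
      refine congrArg₂ _ (Finset.sum_congr rfl fun s _ => mul_comm _ _) rfl
    have h3 : ∑ s ∈ Finset.range (h + 1), ((s : R) + 1) * esym x Finset.univ (m + 2 + s)
          * pathVec x (h + 1 - 1 - s) c
        = ∑ s ∈ Finset.range h, ((s : R) + 1) * esym x Finset.univ (m + 1 + 2 + s)
            * pathVec x (h - 1 - s) c
          + ∑ i ∈ Finset.range (h + 1), esym x Finset.univ (m + 2 + i) * pathVec x (h - i) c := by
      rw [Finset.sum_range_succ', Finset.sum_range_succ' (fun i =>
        esym x Finset.univ (m + 2 + i) * pathVec x (h - i) c), ← add_assoc,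
        ← Finset.sum_add_distrib]
      refine congrArg₂ _ (Finset.sum_congr rfl fun s _ => ?_) (by simp)
      rw [show h + 1 - 1 - (s + 1) = h - 1 - s by omega, show h - (s + 1) = h - 1 - s by omega,
        show m + 2 + (s + 1) = m + 1 + 2 + s by omega]
      push_cast
      ring
    rw [h1, h2, h3, show m + 1 + (h + 1) = m + 1 + 1 + h by omega]
    push_cast
    ring

/-- A path may be read from either end: `x c` times the `(c, d)` entry of the edge matrix is
symmetric in `c` and `d`. -/
theorem cliqueVec_one_vecMul_pow (g : ℕ) (c : C) :
    (cliqueVec x 1 ᵥ* edgeMatrix x ^ g) c = x c * pathVec x g c := by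
  induction g generalizing c with
  | zero => simp [pathVec_zero, cliqueVec_one]
  | succ g ih =>
    rw [pow_succ, ← Matrix.vecMul_vecMul, pathVec_succ, pathSymm,
      ← sum_ite_eq_sub (fun d => x d * pathVec x g d), Matrix.vecMul, dotProduct, Finset.mul_sum]
    refine Finset.sum_congr rfl fun d _ => ?_
    rw [ih, edgeMatrix, Matrix.of_apply]
    simp only [eq_comm (a := d)]
    split_ifs <;> ring

/-- In `cliqueMatrix_mulVec_pathVec` the root colour enters only through `esymErase` and `pathVec`.
Pairing these with the path of length `g` yields a lollipop and a longer path respectively. -/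
theorem kpkpSymm_one (m h g : ℕ) : kpkpSymm x m h 1 g
    = ((m : R) + 1) * lollipopSymm x (m + 2 + h) g
      + (m : R) * ∑ s ∈ Finset.range h, pathSymm x (h - s) * lollipopSymm x (m + 2 + s) g
      + ∑ s ∈ Finset.range h, ((s : R) + 1) * esym x Finset.univ (m + 2 + s)
          * pathSymm x (h + g - s) := by
  have hL : ∀ j, ∑ c, x c * pathVec x g c * esymErase x j c = lollipopSymm x (j + 1) g := by
    intro j
    refine Finset.sum_congr rfl fun c _ => ?_
    rw [cliqueVec_succ]
    ring
  have hP : ∀ j, ∑ c, x c * pathVec x g c * pathVec x j c = pathSymm x (g + j + 1) := by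
    intro j
    rw [← lollipopSymm_one, lollipopSymm, pathVec.eq_1 x (g + j), pow_add, ← Matrix.mulVec_mulVec,
      Matrix.dotProduct_mulVec]
    exact Finset.sum_congr rfl fun c _ => by rw [cliqueVec_one_vecMul_pow]; rfl
  have hexp : ∀ c, (cliqueVec x 1 ᵥ* edgeMatrix x ^ g) c * (cliqueMatrix x m *ᵥ pathVec x h) c
      = ((m : R) + 1) * (x c * pathVec x g c * esymErase x (m + 1 + h) c)
        + (m : R) * ∑ s ∈ Finset.range h,
            pathSymm x (h - s) * (x c * pathVec x g c * esymErase x (m + 1 + s) c)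
        + ∑ s ∈ Finset.range h, ((s : R) + 1) * esym x Finset.univ (m + 2 + s)
            * (x c * pathVec x g c * pathVec x (h - 1 - s) c) := by
    intro c
    rw [cliqueVec_one_vecMul_pow, cliqueMatrix_mulVec_pathVec, mul_add, mul_add, Finset.mul_sum,
      Finset.mul_sum, Finset.mul_sum, Finset.mul_sum]
    refine congrArg₂ _ (congrArg₂ _ (by ring) (Finset.sum_congr rfl fun s _ => by ring))
      (Finset.sum_congr rfl fun s _ => by ring)
  rw [kpkpSymm, dotProduct, Finset.sum_congr rfl fun c _ => hexp c, Finset.sum_add_distrib,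
    Finset.sum_add_distrib, ← Finset.mul_sum, ← Finset.mul_sum, Finset.sum_comm,
    Finset.sum_comm (s := Finset.univ), hL, show m + 1 + h + 1 = m + 2 + h by omega]
  refine congrArg₂ _ (congrArg₂ _ rfl (congrArg₂ _ rfl ?_)) ?_
  · refine Finset.sum_congr rfl fun s _ => ?_
    rw [← Finset.mul_sum, hL, show m + 1 + s + 1 = m + 2 + s by omega]
  · refine Finset.sum_congr rfl fun s hs => ?_
    simp only [Finset.mem_range] at hs
    rw [← Finset.mul_sum, hP, show g + (h - 1 - s) + 1 = h + g - s by omega]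

theorem kpkpSymm_eq_expansion [Algebra ℚ R] {a b : ℕ} (ha : 1 ≤ a) (hb : 2 ≤ b) (g h : ℕ) :
    kpkpSymm x (b - 2) h a g
      = expansion (esym x Finset.univ) (a + g + b + h - 1) a b h := by
  refine eq_expansion (P := pathSymm x) (L := lollipopSymm x) (X := kpkpSymm x (b - 2) h) hb rfl
    (lollipopSymm_zero x) (lollipopSymm_one x) (lollipopSymm_succ x) (fun g => ?_)
    (kpkpSymm_succ x (b - 2) h) ha g
  obtain ⟨m, rfl⟩ : ∃ m, b = m + 2 := ⟨b - 2, by omega⟩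
  rw [Nat.add_sub_cancel, kpkpSymm_one]
  push_cast
  ring

end Transfer

/-! ### Colourings of rooted graphs -/

/-- A proper colouring, as a function. -/
def IsProper {V C : Type*} (G : SimpleGraph V) (κ : V → C) : Prop :=
  ∀ u v, G.Adj u v → κ u ≠ κ v

theorem isProper_sup {V C : Type*} (G H : SimpleGraph V) (κ : V → C) :
    IsProper (G ⊔ H) κ ↔ IsProper G κ ∧ IsProper H κ := by
  simp only [IsProper, SimpleGraph.sup_adj]
  exact ⟨fun h => ⟨fun u v huv => h u v (Or.inl huv), fun u v huv => h u v (Or.inr huv)⟩,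
    fun h u v huv => huv.elim (h.1 u v) (h.2 u v)⟩

theorem isProper_map {V W C : Type*} (G : SimpleGraph V) (f : V ↪ W) (κ : W → C) :
    IsProper (G.map f) κ ↔ IsProper G (κ ∘ f) := by
  constructor
  · intro h u v huv
    exact h _ _ ((SimpleGraph.map_adj _ _ _ _).mpr ⟨u, v, huv, rfl, rfl⟩)
  · intro h u v huv
    obtain ⟨u', v', huv', rfl, rfl⟩ := (SimpleGraph.map_adj _ _ _ _).mp huv
    exact h u' v' huv'

theorem isProper_top {V C : Type*} (κ : V → C) :
    IsProper (⊤ : SimpleGraph V) κ ↔ Function.Injective κ := by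
  simp only [IsProper, SimpleGraph.top_adj]
  exact ⟨fun h u v huv => by_contra fun hne => h u v hne huv, fun h u v huv => h.ne huv⟩

section Transfer

variable {C R : Type*} [Fintype C] [CommRing R] (x : C → R)

open Classical in
/-- The chromatic symmetric polynomial in the variables `x c`. -/
def chromPoly {V : Type*} [Fintype V] (G : SimpleGraph V) : R :=
  ∑ κ : V → C, if IsProper G κ then ∏ v, x (κ v) else 0

theorem chromPoly_eq {V : Type*} [Fintype V] [DecidableEq V] (G : SimpleGraph V)
    [DecidablePred fun κ : V → C => IsProper G κ] :
    chromPoly x G = ∑ κ : V → C, if IsProper G κ then ∏ v, x (κ v) else 0 := by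
  rw [chromPoly]
  congr!

/-- The extension of a colouring of the vertices other than `l` by the colour `c` of `l`. -/
def extend {V : Type*} [DecidableEq V] (l : V) (c : C) (κ : {v // v ≠ l} → C) (v : V) : C :=
  if h : v = l then c else κ ⟨v, h⟩

theorem sum_eq_sum_extend {V : Type*} [Fintype V] [DecidableEq V] (l : V) (F : (V → C) → R) :
    ∑ κ, F κ = ∑ c, ∑ κ : {v // v ≠ l} → C, F (extend l c κ) := by
  rw [← Fintype.sum_prod_type']
  refine Fintype.sum_equiv (Equiv.funSplitAt l C) _ _ fun κ => ?_
  congr 1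
  ext v
  by_cases h : v = l
  · subst h; simp [extend]
  · simp [extend, h]

variable [DecidableEq C]

open Classical in
/-- The transfer matrix of a graph with roots `l` and `r`: its entry at `(c, d)` is the generating
polynomial of the proper colourings with colour `c` at `l` and colour `d` at `r`, where the vertex
`l` does not contribute to the weight. -/
def transfer {V : Type*} [Fintype V] (G : SimpleGraph V) (l r : V) : Matrix C C R :=
  Matrix.of fun c d => ∑ κ : V → C, if IsProper G κ ∧ κ l = c ∧ κ r = d then
    ∏ v, (if v = l then 1 else x (κ v)) else 0

theorem transfer_apply {V : Type*} [Fintype V] [DecidableEq V] (G : SimpleGraph V) (l r : V)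
    [DecidablePred fun κ : V → C => IsProper G κ] (c d : C) :
    transfer x G l r c d = ∑ κ : V → C, if IsProper G κ ∧ κ l = c ∧ κ r = d then
      ∏ v, (if v = l then 1 else x (κ v)) else 0 := by
  rw [transfer, Matrix.of_apply]
  congr!

theorem chromPoly_eq_transfer {V : Type*} [Fintype V] (G : SimpleGraph V) (l r : V) :
    chromPoly x G = (x ᵥ* transfer x G l r) ⬝ᵥ 1 := by
  classical
  rw [dotProduct_one, chromPoly_eq]
  simp only [Matrix.vecMul, dotProduct, transfer_apply, Finset.mul_sum]
  rw [Finset.sum_congr rfl fun _ _ => Finset.sum_comm, Finset.sum_comm]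
  refine Finset.sum_congr rfl fun κ _ => ?_
  by_cases hκ : IsProper G κ
  · simp only [hκ, true_and, if_true, ite_and, mul_ite, mul_zero, Finset.sum_ite_eq,
      Finset.mem_univ]
    rw [← Finset.mul_prod_erase _ _ (Finset.mem_univ l),
      ← Finset.mul_prod_erase _ (fun v => if v = l then (1 : R) else x (κ v)) (Finset.mem_univ l),
      if_pos rfl, one_mul]
    congr 1
    exact Finset.prod_congr rfl fun v hv => by rw [if_neg (Finset.ne_of_mem_erase hv)]
  · simp [hκ]

open Classical in
theorem transfer_apply_extend {V : Type*} [Fintype V] (G : SimpleGraph V) (l r : V) (c d : C) :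
    transfer x G l r c d = ∑ κ : {v // v ≠ l} → C,
      if IsProper G (extend l c κ) ∧ extend l c κ r = d then ∏ v, x (κ v) else 0 := by
  rw [transfer_apply, sum_eq_sum_extend l, Finset.sum_eq_single c]
  · refine Finset.sum_congr rfl fun κ _ => ?_
    have h1 : extend l c κ l = c := by simp [extend]
    have h2 : ∏ v, (if v = l then (1 : R) else x (extend l c κ v)) = ∏ v, x (κ v) := by
      rw [← Finset.mul_prod_erase _ _ (Finset.mem_univ l), if_pos rfl, one_mul,
        Finset.prod_subtype (p := fun v => v ≠ l) (Finset.univ.erase l) (by simp)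
          (fun v => if v = l then (1 : R) else x (extend l c κ v))]
      refine Finset.prod_congr rfl fun v _ => ?_
      rw [if_neg v.2, extend, dif_neg v.2]
    rw [h2]
    exact if_congr (by simp [h1]) rfl rfl
  · intro c' _ hc'
    refine Finset.sum_eq_zero fun κ _ => if_neg ?_
    rintro ⟨-, h, -⟩
    exact hc' (by simpa [extend] using h)
  · simp

/-- A colouring of the glued graph is one of `G` together with colours for the rest of `H`. The
colour of the shared vertex is the summation index of the matrix product, and leaving the left root
out of the weight counts that vertex once. -/
theorem transfer_add (G H : RootedGraph) :
    transfer x (G.add H).graph (G.add H).left (G.add H).right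
      = transfer x G.graph G.left G.right * transfer x H.graph H.left H.right := by
  classical
  ext c d
  have hprod : ∀ f : (G.add H).V → R, ∏ v, f v
      = (∏ v : G.V, f (Sum.inl v)) * ∏ v : {v : H.V // v ≠ H.left}, f (Sum.inr v) := by
    intro f
    exact Eq.trans (Fintype.prod_equiv (Equiv.refl _) _ _ fun _ => rfl)
      (Fintype.prod_sum_type (α₁ := G.V) (α₂ := {v : H.V // v ≠ H.left}) f)
  have hright : ∀ (κ₁ : G.V → C) (κ₂ : {v : H.V // v ≠ H.left} → C),
      Sum.elim κ₁ κ₂ ∘ RootedGraph.inclRight G H = extend H.left (κ₁ G.right) κ₂ := by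
    intro κ₁ κ₂
    ext v
    by_cases h : v = H.left <;> simp [RootedGraph.inclRight, extend, h]
  have hproper : ∀ (κ₁ : G.V → C) (κ₂ : {v : H.V // v ≠ H.left} → C),
      IsProper (G.add H).graph (Sum.elim κ₁ κ₂) ↔
        IsProper G.graph κ₁ ∧ IsProper H.graph (extend H.left (κ₁ G.right) κ₂) := by
    intro κ₁ κ₂
    rw [← hright, ← isProper_map]
    exact (isProper_sup _ _ _).trans (and_congr_left' (isProper_map _ _ _))
  rw [transfer_apply, Matrix.mul_apply]
  have hsum : ∀ F : ((G.add H).V → C) → R, ∑ κ, F κ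
      = ∑ κ₁ : G.V → C, ∑ κ₂ : {v : H.V // v ≠ H.left} → C, F (Sum.elim κ₁ κ₂) := by
    intro F
    rw [← Fintype.sum_prod_type' (fun κ₁ κ₂ => F (Sum.elim κ₁ κ₂))]
    refine Finset.sum_equiv (Equiv.sumArrowEquivProdArrow G.V {v : H.V // v ≠ H.left} C)
      (fun _ => by simp) fun κ _ => ?_
    exact congrArg F (funext fun v => by rcases v with v | v <;> rfl)
  rw [hsum]
  simp only [transfer_apply x G.graph, Finset.sum_mul]
  rw [Finset.sum_comm (s := (Finset.univ : Finset C))]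
  refine Finset.sum_congr rfl fun κ₁ _ => ?_
  rw [Finset.sum_eq_single (κ₁ G.right)]
  · rw [transfer_apply_extend, Finset.mul_sum]
    refine Finset.sum_congr rfl fun κ₂ _ => ?_
    have hr : Sum.elim κ₁ κ₂ (G.add H).right = extend H.left (κ₁ G.right) κ₂ H.right :=
      congrFun (hright κ₁ κ₂) H.right
    have hw : ∏ v, (if v = (G.add H).left then (1 : R) else x (Sum.elim κ₁ κ₂ v))
        = (∏ v, if v = G.left then 1 else x (κ₁ v)) * ∏ v, x (κ₂ v) := by
      rw [hprod]
      refine congrArg₂ _ (Finset.prod_congr rfl fun v _ => ?_)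
        (Finset.prod_congr rfl fun v _ => if_neg Sum.inr_ne_inl)
      exact if_congr Sum.inl_injective.eq_iff rfl rfl
    rw [hw, ite_zero_mul_ite_zero]
    refine if_congr ?_ rfl rfl
    rw [hproper, hr]
    have hl : Sum.elim κ₁ κ₂ (G.add H).left = κ₁ G.left := rfl
    rw [hl]
    tauto
  · intro m _ hm
    rw [if_neg (fun h => hm h.2.2.symm), zero_mul]
  · simp

/-- The transfer matrix of a rooted graph. -/
def rootedTransfer (G : RootedGraph) : Matrix C C R := transfer x G.graph G.left G.right

theorem rootedTransfer_add (G H : RootedGraph) :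
    rootedTransfer x (G.add H) = rootedTransfer x G * rootedTransfer x H := transfer_add x G H

end Transfer

/-! ### Transfer matrices of cliques and paths -/

section CliquePath

variable {C R : Type*} [Fintype C] [CommRing R] (x : C → R)

theorem sum_fin_cons {n : ℕ} (F : (Fin (n + 1) → C) → R) :
    ∑ κ, F κ = ∑ c, ∑ κ : Fin n → C, F (Fin.cons c κ) := by
  rw [← Fintype.sum_prod_type' (fun c κ => F (Fin.cons c κ))]
  exact (Fintype.sum_equiv (Fin.consEquiv fun _ => C) _ _ fun _ => rfl).symm

theorem sum_fin_snoc {n : ℕ} (F : (Fin (n + 1) → C) → R) :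
    ∑ κ, F κ = ∑ c, ∑ κ : Fin n → C, F (Fin.snoc κ c) := by
  rw [← Fintype.sum_prod_type' (fun c (κ : Fin n → C) => F (Fin.snoc (α := fun _ => C) κ c))]
  exact (Fintype.sum_equiv (Fin.snocEquiv fun _ => C) _ _ fun _ => rfl).symm

variable [DecidableEq C]

/-- The sum over injective sequences of colours from `S`. -/
theorem sum_injective_prod (k : ℕ) : ∀ S : Finset C,
    ∑ κ : Fin k → C, (if Function.Injective κ ∧ ∀ i, κ i ∈ S then ∏ i, x (κ i) else 0)
      = (k.factorial : R) * esym x S k := by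
  induction k with
  | zero => intro S; simp [esym_zero, Function.injective_of_subsingleton]
  | succ k ih =>
    intro S
    have h1 : ∀ c, ∑ κ : Fin k → C, (if Function.Injective (Fin.cons c κ : Fin (k + 1) → C) ∧
          ∀ i, (Fin.cons c κ : Fin (k + 1) → C) i ∈ S then
          ∏ i, x ((Fin.cons c κ : Fin (k + 1) → C) i) else 0)
        = if c ∈ S then x c * ((k.factorial : R) * esym x (S.erase c) k) else 0 := by
      intro c
      rw [← ih, Finset.mul_sum]
      split_ifs with hc
      · refine Finset.sum_congr rfl fun κ _ => ?_
        rw [mul_ite_zero, Fin.prod_univ_succ, Fin.cons_zero]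
        simp only [Fin.cons_succ]
        refine if_congr ?_ rfl rfl
        simp only [Fin.cons_injective_iff, Fin.forall_fin_succ, Fin.cons_zero, Fin.cons_succ, hc,
          true_and, Set.mem_range, not_exists, Finset.mem_erase]
        exact ⟨fun H => ⟨H.1.2, fun i => ⟨H.1.1 i, H.2 i⟩⟩,
          fun H => ⟨⟨fun i => (H.2 i).1, H.1⟩, fun i => (H.2 i).2⟩⟩
      · refine Finset.sum_eq_zero fun κ _ => if_neg fun H => hc ?_
        simpa using H.2 0
    rw [sum_fin_cons, Finset.sum_congr rfl fun c _ => h1 c, ← Finset.sum_filter,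
      Finset.filter_mem_eq_inter, Finset.univ_inter, Nat.factorial_succ]
    have h2 := sum_mul_esym_erase x S k
    push_cast
    rw [mul_assoc, mul_left_comm, ← h2, Finset.mul_sum]
    exact Finset.sum_congr rfl fun c _ => by ring

theorem injective_cons_snoc_iff {m : ℕ} {c d : C} (hcd : c ≠ d) (κ : Fin m → C) :
    Function.Injective (Fin.cons c (Fin.snoc κ d : Fin (m + 1) → C) : Fin (m + 2) → C)
      ↔ Function.Injective κ ∧ ∀ i, κ i ∈ (Finset.univ.erase c).erase d := by
  simp only [Fin.cons_injective_iff, Fin.snoc_injective_iff, Set.mem_range, not_exists,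
    Fin.forall_fin_succ', Fin.snoc_castSucc, Fin.snoc_last, Finset.mem_erase, Finset.mem_univ,
    and_true]
  exact ⟨fun H => ⟨H.2.1, fun i => ⟨H.2.2 i, H.1.1 i⟩⟩,
    fun H => ⟨⟨fun i => (H.2 i).2, hcd.symm⟩, H.1, fun i => (H.2 i).1⟩⟩

theorem rootedTransfer_complete (m : ℕ) (h : 1 ≤ m + 2) :
    rootedTransfer x (RootedGraph.complete (m + 2) h) = (m.factorial : R) • cliqueMatrix x m := by
  classical
  change transfer x (⊤ : SimpleGraph (Fin (m + 2))) 0 (Fin.last (m + 1)) = _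
  ext c d
  rw [transfer_apply, sum_fin_cons, Finset.sum_eq_single c, sum_fin_snoc, Finset.sum_eq_single d]
  · rw [Matrix.smul_apply, cliqueMatrix, Matrix.of_apply, smul_eq_mul]
    split_ifs with hcd
    · rw [mul_zero]
      refine Finset.sum_eq_zero fun κ _ => if_neg fun H => ?_
      have h1 := ((isProper_top _).mp H.1)
      rw [Fin.cons_injective_iff] at h1
      exact h1.1 ⟨Fin.last m, by rw [Fin.snoc_last, hcd]⟩
    · rw [mul_left_comm, ← sum_injective_prod, Finset.mul_sum]
      refine Finset.sum_congr rfl fun κ _ => ?_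
      rw [mul_ite_zero]
      refine if_congr ?_ ?_ rfl
      · rw [isProper_top, injective_cons_snoc_iff hcd, ← Fin.succ_last, Fin.cons_succ,
          Fin.snoc_last, Fin.cons_zero]
        simp
      · rw [Fin.prod_univ_succ, if_pos rfl, one_mul]
        simp only [Fin.succ_ne_zero, if_false, Fin.cons_succ]
        rw [Fin.prod_univ_castSucc, Fin.snoc_last, mul_comm]
        simp only [Fin.snoc_castSucc]
  · intro d' _ hd'
    refine Finset.sum_eq_zero fun κ _ => if_neg fun H => hd' ?_
    have := H.2.2
    rwa [← Fin.succ_last, Fin.cons_succ, Fin.snoc_last] at this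
  · simp
  · intro c' _ hc'
    exact Finset.sum_eq_zero fun κ _ => if_neg fun H => hc' (by simpa using H.2.1)
  · simp

/-- The leftmost clique is needed only multiplied by the weights of its left root. This form also
covers `K_1`, whose two roots coincide, which `cliqueMatrix` does not. -/
theorem vecMul_rootedTransfer_complete (k : ℕ) (h : 1 ≤ k + 1) :
    x ᵥ* rootedTransfer x (RootedGraph.complete (k + 1) h)
      = (k.factorial : R) • cliqueVec x (k + 1) := by
  classical
  change x ᵥ* transfer x (⊤ : SimpleGraph (Fin (k + 1))) 0 (Fin.last k) = _
  ext d
  have h1 : (x ᵥ* transfer x (⊤ : SimpleGraph (Fin (k + 1))) 0 (Fin.last k)) d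
      = ∑ κ : Fin (k + 1) → C, if Function.Injective κ ∧ κ (Fin.last k) = d then
          ∏ i, x (κ i) else 0 := by
    simp only [Matrix.vecMul, dotProduct, transfer_apply, Finset.mul_sum]
    rw [Finset.sum_comm]
    refine Finset.sum_congr rfl fun κ _ => ?_
    rw [Finset.sum_eq_single (κ 0)]
    · simp only [isProper_top, true_and, mul_ite_zero]
      refine if_congr Iff.rfl ?_ rfl
      rw [Fin.prod_univ_succ, Fin.prod_univ_succ (f := fun i => x (κ i)), if_pos rfl, one_mul]
      simp only [Fin.succ_ne_zero, if_false]
    · intro c _ hc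
      rw [if_neg fun H => hc H.2.1.symm, mul_zero]
    · simp
  rw [h1, sum_fin_snoc, Finset.sum_eq_single d]
  · rw [Pi.smul_apply, cliqueVec_succ, smul_eq_mul, mul_left_comm, esymErase,
      ← sum_injective_prod, Finset.mul_sum]
    refine Finset.sum_congr rfl fun κ _ => ?_
    rw [mul_ite_zero, Fin.prod_univ_castSucc, Fin.snoc_last, mul_comm]
    simp only [Fin.snoc_castSucc]
    refine if_congr ?_ rfl rfl
    simp [Fin.snoc_injective_iff]
  · intro d' _ hd'
    exact Finset.sum_eq_zero fun κ _ => if_neg fun H => hd' (by simpa using H.2)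
  · simp

omit [Fintype C] [DecidableEq C] in
theorem isProper_pathGraph_cons {k : ℕ} (c : C) (κ : Fin (k + 1) → C) :
    IsProper (SimpleGraph.pathGraph (k + 2)) (Fin.cons c κ : Fin (k + 2) → C)
      ↔ c ≠ κ 0 ∧ IsProper (SimpleGraph.pathGraph (k + 1)) κ := by
  simp only [IsProper, SimpleGraph.pathGraph_adj]
  constructor
  · intro H
    refine ⟨by simpa using H 0 (Fin.succ 0) (by simp), fun u v huv => ?_⟩
    simpa using H u.succ v.succ (by simp; omega)
  · rintro ⟨h0, H⟩ u v huv
    induction u using Fin.cases with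
    | zero =>
      induction v using Fin.cases with
      | zero => simp at huv
      | succ v =>
        obtain rfl : v = 0 := by
          apply Fin.ext
          simp at huv ⊢
          omega
        simpa using h0
    | succ u =>
      induction v using Fin.cases with
      | zero =>
        obtain rfl : u = 0 := by
          apply Fin.ext
          simp at huv ⊢
          omega
        simpa using h0.symm
      | succ v =>
        simp only [Fin.cons_succ]
        exact H u v (by simp at huv; omega)

theorem transfer_pathGraph (k : ℕ) :
    transfer x (SimpleGraph.pathGraph (k + 1)) 0 (Fin.last k) = edgeMatrix x ^ k := by
  classical
  induction k with
  | zero =>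
    ext c d
    rw [transfer_apply, sum_fin_cons, Finset.sum_eq_single c]
    · simp [IsProper, SimpleGraph.pathGraph_adj, Matrix.one_apply]
    · intro c' _ hc'
      exact Finset.sum_eq_zero fun κ _ => if_neg fun H => hc' (by simpa using H.2.1)
    · simp
  | succ k ih =>
    ext c d
    rw [pow_succ', ← ih, Matrix.mul_apply, transfer_apply, sum_fin_cons, Finset.sum_eq_single c]
    · simp only [transfer_apply, Finset.mul_sum]
      rw [Finset.sum_comm]
      refine Finset.sum_congr rfl fun κ _ => ?_
      rw [Finset.sum_eq_single (κ 0)]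
      · rw [edgeMatrix, Matrix.of_apply, isProper_pathGraph_cons, ← Fin.succ_last, Fin.cons_succ,
          Fin.prod_univ_succ, if_pos rfl, one_mul]
        simp only [Fin.succ_ne_zero, if_false, Fin.cons_succ, Fin.cons_zero, true_and]
        rw [Fin.prod_univ_succ, Fin.prod_univ_succ (f := fun v => if v = 0 then 1 else x (κ v)),
          if_pos rfl, one_mul]
        simp only [Fin.succ_ne_zero, if_false]
        by_cases h0 : c = κ 0
        · simp [h0]
        · simp [h0]
      · intro e _ he
        rw [if_neg fun H => he H.2.1.symm, mul_zero]
      · simp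
    · intro c' _ hc'
      exact Finset.sum_eq_zero fun κ _ => if_neg fun H => hc' (by simpa using H.2.1)
    · simp

theorem rootedTransfer_path (k : ℕ) (h : 1 ≤ k + 1) :
    rootedTransfer x (RootedGraph.path (k + 1) h) = edgeMatrix x ^ k := transfer_pathGraph x k

theorem chromPoly_kpkp {a b : ℕ} (g h : ℕ) (ha : 1 ≤ a) (hb : 2 ≤ b) (hb' : 1 ≤ b) :
    chromPoly x (RootedGraph.kpkp a g b h ha hb').graph
      = ((a - 1).factorial : R) * ((b - 2).factorial : R) * kpkpSymm x (b - 2) h a g := by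
  obtain ⟨k, rfl⟩ : ∃ k, a = k + 1 := ⟨a - 1, by omega⟩
  obtain ⟨m, rfl⟩ : ∃ m, b = m + 2 := ⟨b - 2, by omega⟩
  rw [chromPoly_eq_transfer x _ (RootedGraph.kpkp (k + 1) g (m + 2) h ha hb').left
    (RootedGraph.kpkp (k + 1) g (m + 2) h ha hb').right, ← rootedTransfer]
  rw [RootedGraph.kpkp, RootedGraph.lollipop, rootedTransfer_add, rootedTransfer_add,
    rootedTransfer_add, rootedTransfer_path, rootedTransfer_path, rootedTransfer_complete,
    ← Matrix.vecMul_vecMul, vecMul_rootedTransfer_complete, ← Matrix.vecMul_vecMul,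
    ← Matrix.vecMul_vecMul, ← Matrix.dotProduct_mulVec, ← pathVec, ← Matrix.dotProduct_mulVec,
    Matrix.smul_vecMul, Matrix.smul_mulVec, smul_dotProduct, dotProduct_smul, kpkpSymm]
  simp only [smul_eq_mul, Nat.add_sub_cancel]
  ring

end CliquePath

/-! ### Restriction to finitely many variables -/

/-- Two power series agree on the monomials in the variables from `S`. -/
def AgreeOn (S : Finset ℕ) (f g : MvPowerSeries ℕ ℚ) : Prop :=
  ∀ d : ℕ →₀ ℕ, d.support ⊆ S → MvPowerSeries.coeff d f = MvPowerSeries.coeff d g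

namespace AgreeOn

variable {S : Finset ℕ} {f g f' g' : MvPowerSeries ℕ ℚ}

theorem refl (f : MvPowerSeries ℕ ℚ) : AgreeOn S f f := fun _ _ => rfl

theorem add (h : AgreeOn S f g) (h' : AgreeOn S f' g') : AgreeOn S (f + f') (g + g') :=
  fun d hd => by rw [map_add, map_add, h d hd, h' d hd]

theorem mul (h : AgreeOn S f g) (h' : AgreeOn S f' g') : AgreeOn S (f * f') (g * g') := by
  intro d hd
  rw [MvPowerSeries.coeff_mul, MvPowerSeries.coeff_mul]
  refine Finset.sum_congr rfl fun p hp => ?_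
  have hp := Finset.HasAntidiagonal.mem_antidiagonal.mp hp
  have h1 : p.1.support ⊆ S :=
    (Finsupp.support_mono (hp ▸ le_self_add : p.1 ≤ d)).trans hd
  have h2 : p.2.support ⊆ S :=
    (Finsupp.support_mono (hp ▸ le_add_self : p.2 ≤ d)).trans hd
  rw [h _ h1, h' _ h2]

theorem sum {ι : Type*} {s : Finset ι} {F G : ι → MvPowerSeries ℕ ℚ}
    (h : ∀ i ∈ s, AgreeOn S (F i) (G i)) : AgreeOn S (∑ i ∈ s, F i) (∑ i ∈ s, G i) := by
  intro d hd
  rw [map_sum, map_sum]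
  exact Finset.sum_congr rfl fun i hi => h i hi d hd

theorem prodMap {e e' : ℕ → MvPowerSeries ℕ ℚ} (h : ∀ k, AgreeOn S (e k) (e' k)) (l : List ℕ) :
    AgreeOn S (KPKP.prodMap e l) (KPKP.prodMap e' l) := by
  induction l with
  | nil => exact refl _
  | cons k l ih =>
    simp only [KPKP.prodMap, List.map_cons, List.prod_cons]
    exact (h k).mul ih

theorem expansion {e e' : ℕ → MvPowerSeries ℕ ℚ} (h : ∀ k, AgreeOn S (e k) (e' k))
    (n a b m : ℕ) : AgreeOn S (KPKP.expansion e n a b m) (KPKP.expansion e' n a b m) := by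
  refine ((refl _).mul (h n)).add (sum fun K _ => ?_)
  dsimp only
  split_ifs
  · exact (refl _).mul (prodMap h _)
  · exact refl _

end AgreeOn

/-- The variables with index in `S`. -/
def var (S : Finset ℕ) (i : S) : MvPowerSeries ℕ ℚ := MvPowerSeries.X (i : ℕ)

theorem prod_var_eq_monomial {S : Finset ℕ} {ι : Type*} (t : Finset ι) (f : ι → S) :
    ∏ i ∈ t, var S (f i)
      = MvPowerSeries.monomial (∑ i ∈ t, Finsupp.single (f i : ℕ) 1) (1 : ℚ) := by
  classical
  induction t using Finset.induction_on with
  | empty => simp [MvPowerSeries.monomial_zero_one]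
  | insert i t hi ih =>
    rw [Finset.prod_insert hi, Finset.sum_insert hi, ih, var, MvPowerSeries.X,
      MvPowerSeries.monomial_mul_monomial, one_mul]

theorem sum_single_apply {S : Finset ℕ} (t : Finset S) (i : S) :
    (∑ j ∈ t, Finsupp.single (j : ℕ) 1) (i : ℕ) = if i ∈ t then 1 else 0 := by
  rw [Finsupp.finsetSum_apply, ← Finset.sum_ite_eq' t i (fun _ => 1)]
  refine Finset.sum_congr rfl fun j _ => ?_
  rw [Finsupp.single_apply]
  exact if_congr Subtype.ext_iff.symm rfl rfl

theorem sum_single_apply_of_notMem {S : Finset ℕ} (t : Finset S) {i : ℕ} (hi : i ∉ S) :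
    (∑ j ∈ t, Finsupp.single (j : ℕ) 1 : ℕ →₀ ℕ) i = 0 := by
  rw [Finsupp.finsetSum_apply]
  refine Finset.sum_eq_zero fun j _ => ?_
  rw [Finsupp.single_apply, if_neg]
  rintro rfl
  exact hi j.2

theorem agreeOn_elem (S : Finset ℕ) (k : ℕ) :
    AgreeOn S (elem k) (esym (var S) Finset.univ k) := by
  classical
  intro d hd
  have hdeg : ∀ t : Finset S,
      (∑ j ∈ t, Finsupp.single (j : ℕ) 1 : ℕ →₀ ℕ).degree = t.card := by
    intro t
    rw [map_sum]
    simp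
  rw [esym, map_sum]
  simp only [prod_var_eq_monomial _ (fun i : S => i), MvPowerSeries.coeff_monomial]
  change (if (∀ i, d i ≤ 1) ∧ d.degree = k then (1 : ℚ) else 0) = _
  split_ifs with h
  · obtain ⟨h1, h2⟩ := h
    have ht : d = ∑ j ∈ Finset.univ.filter (fun i : S => d i ≠ 0), Finsupp.single (j : ℕ) 1 := by
      ext i
      by_cases hi : i ∈ S
      · have := sum_single_apply (Finset.univ.filter (fun i : S => d i ≠ 0)) ⟨i, hi⟩
        simp only at this
        rw [this]
        have := h1 i
        simp only [Finset.mem_filter, Finset.mem_univ, true_and]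
        split_ifs <;> omega
      · rw [sum_single_apply_of_notMem _ hi]
        by_contra h0
        exact hi (hd (Finsupp.mem_support_iff.mpr h0))
    rw [Finset.sum_eq_single (Finset.univ.filter (fun i : S => d i ≠ 0)), if_pos ht]
    · intro t _ hne
      rw [if_neg]
      rintro rfl
      apply hne
      ext i
      simp [sum_single_apply]
    · intro hmem
      exfalso
      apply hmem
      rw [Finset.mem_powersetCard]
      refine ⟨Finset.subset_univ _, ?_⟩
      rw [← hdeg, ← ht, h2]
  · symm
    refine Finset.sum_eq_zero fun t ht => if_neg ?_
    rintro rfl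
    refine h ⟨fun i => ?_, ?_⟩
    · by_cases hi : i ∈ S
      · have := sum_single_apply t ⟨i, hi⟩
        simp only at this
        rw [this]
        split_ifs <;> omega
      · rw [sum_single_apply_of_notMem _ hi]
        omega
    · rw [hdeg, (Finset.mem_powersetCard.mp ht).2]

theorem mem_support_content {V : Type*} [Fintype V] (κ : V → ℕ) (v : V) :
    κ v ∈ (content κ).support := by
  rw [Finsupp.mem_support_iff, content, Finsupp.finsetSum_apply]
  intro h
  have := (Finset.sum_eq_zero_iff.mp h) v (Finset.mem_univ v)
  simp at this

/-- A colouring whose monomial has support in `S` uses only colours from `S`, so it is a colouring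
with finitely many colours. -/
theorem agreeOn_chromSymm (S : Finset ℕ) {V : Type*} [Fintype V] (G : SimpleGraph V) :
    AgreeOn S (chromSymm G) (chromPoly (var S) G) := by
  classical
  intro d hd
  let T := {κ : V → S // IsProper G κ ∧ content (fun v => (κ v : ℕ)) = d}
  have h1 : MvPowerSeries.coeff d (chromPoly (var S) G) = (Fintype.card T : ℚ) := by
    rw [chromPoly_eq, map_sum, Fintype.card_subtype, Finset.card_filter, Nat.cast_sum]
    refine Finset.sum_congr rfl fun κ _ => ?_
    rw [prod_var_eq_monomial, apply_ite (MvPowerSeries.coeff d), MvPowerSeries.coeff_monomial,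
      map_zero, ite_and, Nat.cast_ite, Nat.cast_ite]
    simp only [Nat.cast_one, Nat.cast_zero]
    refine if_congr Iff.rfl (if_congr ?_ rfl rfl) rfl
    exact eq_comm
  rw [h1, ← Nat.card_eq_fintype_card]
  change ((Nat.card {κ : G.Coloring ℕ // content κ = d} : ℕ) : ℚ) = _
  congr 1
  let F : T → {κ : G.Coloring ℕ // content κ = d} := fun κ =>
    ⟨SimpleGraph.Coloring.mk (fun v => (κ.1 v : ℕ))
      (fun {u v} huv h => κ.2.1 u v huv (Subtype.ext h)), κ.2.2⟩
  symm
  refine Nat.card_eq_of_bijective F ⟨?_, ?_⟩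
  · intro κ κ' h
    apply Subtype.ext
    ext v
    exact congrArg (fun κ : {κ : G.Coloring ℕ // content κ = d} => κ.1 v) h
  · rintro ⟨κ, rfl⟩
    refine ⟨⟨fun v => ⟨κ v, hd (mem_support_content κ v)⟩, ?_, rfl⟩, ?_⟩
    · intro u v huv h
      exact κ.valid huv (congrArg Subtype.val h)
    · apply Subtype.ext
      apply RelHom.ext
      intro v
      rfl

theorem smul_chromSymm_kpkp {a b : ℕ} (g h : ℕ) (ha : 1 ≤ a) (hb : 2 ≤ b) (hb' : 1 ≤ b) :
    (((a - 1).factorial : ℚ) * ((b - 2).factorial : ℚ))⁻¹ •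
        chromSymm (RootedGraph.kpkp a g b h ha hb').graph
      = expansion elem (a + g + b + h - 1) a b h := by
  ext d
  have hfac : ((a - 1).factorial : ℚ) * ((b - 2).factorial : ℚ) ≠ 0 := by positivity
  have hcast : ((a - 1).factorial : MvPowerSeries ℕ ℚ) * ((b - 2).factorial : MvPowerSeries ℕ ℚ)
      = algebraMap ℚ _ (((a - 1).factorial : ℚ) * ((b - 2).factorial : ℚ)) := by
    rw [map_mul, map_natCast, map_natCast]
  -- For the coefficient at `d`, the variables in the support of `d` suffice.
  rw [AgreeOn.expansion (S := d.support) (agreeOn_elem d.support) _ a b h d subset_rfl,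
    ← kpkpSymm_eq_expansion (var d.support) ha hb g h, MvPowerSeries.coeff_smul,
    agreeOn_chromSymm d.support _ d subset_rfl, chromPoly_kpkp _ g h ha hb hb', hcast,
    ← Algebra.smul_def, MvPowerSeries.coeff_smul, inv_mul_cancel_left₀ hfac]

/-! ### The ranges of summation -/

/-- The left side says that the least partial sum past `h` is at least `h + b`. The bound `h + 1 ≤
n` provides such a partial sum, so the infimum is attained and is not the default value `0`. -/
theorem le_Theta_iff_gap {n h b : ℕ} (hb : 1 ≤ b) (hn : h + 1 ≤ n) (K : Composition n) :
    b - 1 ≤ Theta K (h + 1) ↔ Gap h b K.blocks := by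
  have hne : {s | ∃ j ≤ K.length, s = K.sizeUpTo j ∧ h + 1 ≤ s}.Nonempty :=
    ⟨n, K.length, le_rfl, K.sizeUpTo_length.symm, hn⟩
  have hle : ∀ j ≤ K.length, h + 1 ≤ K.sizeUpTo j → sigma K (h + 1) ≤ K.sizeUpTo j :=
    fun j hj h1 => Nat.sInf_le ⟨j, hj, rfl, h1⟩
  obtain ⟨j, hj, hs, hm⟩ := Nat.sInf_mem hne
  change sigma K (h + 1) = _ at hs
  change h + 1 ≤ sigma K (h + 1) at hm
  rw [Theta]
  constructor
  · intro H p hp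
    have := hle p.length hp.length_le
    rw [Composition.sizeUpTo, ← List.prefix_iff_eq_take.mp hp] at this
    omega
  · intro H
    have := H _ (List.take_prefix j K.blocks)
    change K.sizeUpTo j ≤ h ∨ h + b ≤ K.sizeUpTo j at this
    omega

theorem sum_eq_expansion {n a b h : ℕ} (hb : 2 ≤ b) (hn : h + 1 ≤ n) :
    (((b : ℚ) - 1) * (n : ℚ)) • elem n
        + ∑ K ∈ A₁ n a b h, f₁ b K
        + ∑ K ∈ A₂ n a b h, f₁ b K
        + ∑ K ∈ A₃ n a b h, f₂ b K
        - ∑ K ∈ A₄ n a b h, f₃ b K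
        + ∑ K ∈ A₅ n a b h, f₃ b K
      = expansion elem n a b h := by
  classical
  have hT : ∀ K : Composition n, b - 1 ≤ Theta K (h + 1) ↔ Gap h b K.blocks := fun K =>
    le_Theta_iff_gap (by omega) hn K
  have hT' : ∀ K : Composition n, Theta K (h + 1) ≤ b - 2 ↔ ¬ Gap h b K.blocks := fun K => by
    rw [← hT]; omega
  rw [expansion, ← Algebra.smul_def, A₁, A₂, A₃, A₄, A₅]
  simp only [Finset.sum_filter, hT, hT', add_assoc, sub_eq_add_neg, ← Finset.sum_neg_distrib]
  simp only [← Finset.sum_add_distrib]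
  congr 1
  refine Finset.sum_congr rfl fun K _ => ?_
  have hlen : K.blocks.length = K.length := rfl
  by_cases hl : 2 ≤ K.length
  · simp only [hlen, hl, true_and, if_true, expansionCoeff, ← Algebra.smul_def, add_smul, neg_smul,
      ite_smul, zero_smul, sub_eq_add_neg, add_assoc]
    congr!
  · simp [hlen, hl]

/-! ### Positivity -/

theorem predProd_nonneg {l : List ℕ} (hl : ∀ x ∈ l, 0 < x) : 0 ≤ predProd l := by
  refine List.prod_nonneg fun q hq => ?_
  obtain ⟨j, hj, rfl⟩ := List.mem_map.mp hq
  have : (1 : ℚ) ≤ j := by exact_mod_cast hl j hj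
  linarith

theorem w_nonneg {l : List ℕ} (hl : ∀ x ∈ l, 0 < x) : 0 ≤ w l := by
  rcases l with _ | ⟨k, l⟩
  · exact zero_le_one
  · rw [w_cons]
    exact mul_nonneg (Nat.cast_nonneg _)
      (predProd_nonneg fun x hx => hl x (List.mem_cons_of_mem _ hx))

theorem w_dropLast_nonneg {n : ℕ} (K : Composition n) : 0 ≤ w K.blocks.dropLast :=
  w_nonneg fun _ hx => K.blocks_pos (List.mem_of_mem_dropLast hx)

end KPKP

end

/-- The positive `e_I`-expansion of the chromatic symmetric function of a KPKP graph. The first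
conjunct is the formula; the others say that every coefficient in the expansion is nonnegative. -/
theorem mainTheorem1 (n a g b h : ℕ) (ha : 1 ≤ a) (hb : 2 ≤ b) (hn : n = a + g + b + h - 1) :
    (((a - 1).factorial : ℚ) * ((b - 2).factorial : ℚ))⁻¹ •
        KPKP.chromSymm (KPKP.RootedGraph.kpkp a g b h ha (le_trans one_le_two hb)).graph
      = (((b : ℚ) - 1) * (n : ℚ)) • KPKP.elem n
        + ∑ K ∈ KPKP.A₁ n a b h, KPKP.f₁ b K
        + ∑ K ∈ KPKP.A₂ n a b h, KPKP.f₁ b K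
        + ∑ K ∈ KPKP.A₃ n a b h, KPKP.f₂ b K
        - ∑ K ∈ KPKP.A₄ n a b h, KPKP.f₃ b K
        + ∑ K ∈ KPKP.A₅ n a b h, KPKP.f₃ b K
    ∧ 0 ≤ ((b : ℚ) - 1) * (n : ℚ)
    ∧ (∀ K ∈ KPKP.A₁ n a b h ∪ KPKP.A₂ n a b h, 0 ≤ KPKP.c₁ b K)
    ∧ (∀ K ∈ KPKP.A₃ n a b h, 0 ≤ KPKP.c₂ b K)
    ∧ (∀ K ∈ KPKP.A₄ n a b h, 0 ≤ -KPKP.c₃ b K)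
    ∧ (∀ K ∈ KPKP.A₅ n a b h, 0 ≤ KPKP.c₃ b K) := by
  have hb2 : (2 : ℚ) ≤ b := by exact_mod_cast hb
  refine ⟨?_, mul_nonneg (by linarith) (Nat.cast_nonneg _), fun K _ => ?_, fun K _ => ?_,
    fun K hK => ?_, fun K hK => ?_⟩
  · rw [KPKP.sum_eq_expansion hb (by omega), hn,
      KPKP.smul_chromSymm_kpkp g h ha hb (le_trans one_le_two hb)]
  · exact mul_nonneg (by linarith) (KPKP.w_nonneg fun _ hx => K.blocks_pos hx)
  · exact mul_nonneg (mul_nonneg (by linarith) (Nat.cast_nonneg _)) (KPKP.w_dropLast_nonneg K)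
  · simp only [KPKP.A₄, Finset.mem_filter, Finset.mem_univ, true_and] at hK
    have hlt : KPKP.last₁ K + 1 ≤ b := by omega
    have hlt' : (KPKP.last₁ K : ℚ) + 1 ≤ b := by exact_mod_cast hlt
    rw [KPKP.c₃, ← neg_mul]
    exact mul_nonneg (by linarith) (KPKP.w_dropLast_nonneg K)
  · simp only [KPKP.A₅, Finset.mem_filter, Finset.mem_univ, true_and] at hK
    have hlt : b ≤ KPKP.last₁ K + 1 := by omega
    have hlt' : (b : ℚ) ≤ (KPKP.last₁ K : ℚ) + 1 := by exact_mod_cast hlt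
    exact mul_nonneg (by linarith) (KPKP.w_dropLast_nonneg K)
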